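/- Theorem. Consider the decision problem **$b$-Most Vital Edges in MST**: the input is a finite nonempty simple graph $G=(V,E)$ with edge weights $w:E\to\mathbb{Z}_{\ge 0}$ and two positive integers $b$ and $r$, and the question is whether there is a set $I\subseteq E$ with $|I|\le b$ such that $\eta(G-I)\ge r$. Here $\eta(H)$ denotes the weight of a minimum spanning tree of $H$, with $\eta(H)=\infty$ if $H$ is disconnected. Parameterized by $r$, the required weight of the minimum spanning tree of $G-I$, this problem is W[1]-hard: every parameterized problem in W[1] reduces to it by a parameterized reduction. (A parameterized reduction is a map of instances that preserves the answer, is computable in time $f(k)\cdot \mathrm{poly}(|x|)$, and produces an instance with parameter at most $g(k)$, where $|x|$ is the input size, $k$ is the parameter, and $f,g$ are computable functions. W[1] is the class of parameterized problems that reduce in this way, for some fixed $d$, to the problem of deciding whether a $d$-CNF formula has a satisfying assignment with exactly $k$ true variables, parameterized by $k$.) -/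

import Mathlib

/-!
# Random access machines, parameterized reductions, W[1], and most vital edges for spanning trees
-/

namespace ParamComplexity

/-! ## A machine model with a step count

Structured programs for a random access machine with finitely many registers and finitely many
arrays (a fixed program mentions only finitely many of each), all cells holding natural numbers.
The arithmetic is addition, truncated subtraction, and halving rounded down, under the uniform cost
measure; there is no multiplication, so `t` steps lengthen numbers by only `O(t)` bits and the
model is polynomially equivalent to Turing machines. -/

/-- A memory state: the registers, and the arrays (`arr a i` is cell `i` of array `a`). -/
structure State where
  reg : ℕ → ℕ
  arr : ℕ → ℕ → ℕ

/-- Arithmetic expressions. `cell a e` reads array `a` at the index given by the value of `e`. -/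
inductive Term where
  | const (n : ℕ)
  | reg (x : ℕ)
  | cell (a : ℕ) (e : Term)
  | add (e₁ e₂ : Term)
  | sub (e₁ e₂ : Term)
  | half (e : Term)

/-- The value of an expression in a state. -/
def Term.val (s : State) : Term → ℕ
  | .const n => n
  | .reg x => s.reg x
  | .cell a e => s.arr a (e.val s)
  | .add e₁ e₂ => e₁.val s + e₂.val s
  | .sub e₁ e₂ => e₁.val s - e₂.val s
  | .half e => e.val s / 2

/-- The number of operations needed to evaluate an expression. -/
def Term.cost : Term → ℕ
  | .const _ => 1
  | .reg _ => 1
  | .cell _ e => e.cost + 1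
  | .add e₁ e₂ => e₁.cost + e₂.cost + 1
  | .sub e₁ e₂ => e₁.cost + e₂.cost + 1
  | .half e => e.cost + 1

/-- Programs. `store a e₁ e₂` writes the value of `e₂` into array `a` at index `e₁`; the tests of
`ite` and `loop` succeed when the value of the expression is nonzero. -/
inductive Prog where
  | skip
  | assign (x : ℕ) (e : Term)
  | store (a : ℕ) (e₁ e₂ : Term)
  | seq (p q : Prog)
  | ite (e : Term) (p q : Prog)
  | loop (e : Term) (p : Prog)

/-- Replace the content of register `x`. -/
def State.setReg (s : State) (x v : ℕ) : State :=
  { s with reg := Function.update s.reg x v }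

/-- Replace the content of cell `i` of array `a`. -/
def State.setCell (s : State) (a i v : ℕ) : State :=
  { s with arr := Function.update s.arr a (Function.update (s.arr a) i v) }

/-- `Exec p s s' t`: the program `p`, started in state `s`, halts in state `s'` after exactly `t`
steps. -/
inductive Exec : Prog → State → State → ℕ → Prop where
  | skip (s : State) : Exec .skip s s 1
  | assign (s : State) (x : ℕ) (e : Term) :
      Exec (.assign x e) s (s.setReg x (e.val s)) (e.cost + 1)
  | store (s : State) (a : ℕ) (e₁ e₂ : Term) :
      Exec (.store a e₁ e₂) s (s.setCell a (e₁.val s) (e₂.val s)) (e₁.cost + e₂.cost + 1)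
  | seq {p q : Prog} {s s' s'' : State} {t t' : ℕ} :
      Exec p s s' t → Exec q s' s'' t' → Exec (.seq p q) s s'' (t + t')
  | ite_true {e : Term} {p q : Prog} {s s' : State} {t : ℕ} :
      e.val s ≠ 0 → Exec p s s' t → Exec (.ite e p q) s s' (e.cost + 1 + t)
  | ite_false {e : Term} {p q : Prog} {s s' : State} {t : ℕ} :
      e.val s = 0 → Exec q s s' t → Exec (.ite e p q) s s' (e.cost + 1 + t)
  | loop_done {e : Term} {p : Prog} {s : State} :
      e.val s = 0 → Exec (.loop e p) s s (e.cost + 1)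
  | loop_step {e : Term} {p : Prog} {s s' s'' : State} {t t' : ℕ} :
      e.val s ≠ 0 → Exec p s s' t → Exec (.loop e p) s' s'' t' →
      Exec (.loop e p) s s'' (e.cost + 1 + t + t')

/-! ## Parameterized problems and parameterized reductions -/

/-- An instance of a parameterized problem: a finite sequence of natural numbers (the encoded
input) together with the parameter. -/
abbrev Instance := List ℕ × ℕ

/-- A parameterized decision problem: its set of yes-instances. -/
abbrev Problem := Set Instance

/-- The size of an encoded input: the total number of binary digits, plus one per entry. -/
def size (x : List ℕ) : ℕ := (x.map fun m => Nat.size m + 1).sum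

/-- The initial state on an instance: the input in array `0`, its length in register `0`, the
parameter in register `1`, and zeros everywhere else. -/
def initial (i : Instance) : State where
  reg x := if x = 0 then i.1.length else if x = 1 then i.2 else 0
  arr a j := if a = 0 then i.1.getD j 0 else 0

/-- The state presents the instance `i` as its output: the length in register `0`, the parameter in
register `1`, the sequence itself at the beginning of array `0`. -/
def State.Presents (s : State) (i : Instance) : Prop :=
  s.reg 0 = i.1.length ∧ s.reg 1 = i.2 ∧ ∀ j, j < i.1.length → s.arr 0 j = i.1.getD j 0

/-- `A` reduces to `B` by a parameterized (many-one) reduction: a map `F` of instances that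
preserves the answer, is computed by a program within `f k * (size x + 1) ^ c` steps, and increases
the parameter to at most `g k`, where `f` and `g` are computable. -/
def Reduces (A B : Problem) : Prop :=
  ∃ (F : Instance → Instance) (p : Prog) (f g : ℕ → ℕ) (c : ℕ),
    Computable f ∧ Computable g ∧
    (∀ i, i ∈ A ↔ F i ∈ B) ∧
    (∀ i, (F i).2 ≤ g i.2) ∧
    ∀ i, ∃ (s : State) (t : ℕ),
      Exec p (initial i) s t ∧ s.Presents (F i) ∧ t ≤ f i.2 * (size i.1 + 1) ^ c

/-! ## The class W[1] -/

/-- A literal: a variable and its sign (`true` for a positive literal). -/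
abbrev Literal := ℕ × Bool

/-- A formula in conjunctive normal form: a conjunction of disjunctions of literals. -/
abbrev CNF := List (List Literal)

/-- The literal holds in the assignment that makes exactly the variables in `S` true. -/
def Literal.Holds (S : Finset ℕ) (l : Literal) : Prop := l.1 ∈ S ↔ l.2 = true

/-- The variables that occur in a formula. -/
def CNF.vars (φ : CNF) : Finset ℕ := (φ.flatten.map Prod.fst).toFinset

/-- The assignment that makes exactly the variables in `S` true satisfies the formula. -/
def CNF.Satisfies (φ : CNF) (S : Finset ℕ) : Prop := ∀ C ∈ φ, ∃ l ∈ C, Literal.Holds S l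

/-- The code of a literal, a positive number. -/
def Literal.code (l : Literal) : ℕ := if l.2 = true then 2 * l.1 + 1 else 2 * l.1 + 2

/-- A formula is written clause by clause, every clause being terminated by a zero. -/
def CNF.encode (φ : CNF) : List ℕ := φ.flatMap fun C => C.map Literal.code ++ [0]

/-- Weighted `d`-CNF satisfiability: does a formula in conjunctive normal form, with at most `d`
literals in every clause, have a satisfying assignment with exactly `k` true variables? The
parameter is `k`. -/
def WeightedSat (d : ℕ) : Problem :=
  {i | ∃ φ : CNF, i.1 = φ.encode ∧ (∀ C ∈ φ, C.length ≤ d) ∧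
    ∃ S : Finset ℕ, S ⊆ φ.vars ∧ S.card = i.2 ∧ φ.Satisfies S}

/-- The class W[1]: the closure under parameterized reductions of the weighted satisfiability
problems for formulas of weft one, that is, for `d`-CNF formulas with `d` fixed. -/
def W1 : Set Problem := {A | ∃ d, Reduces A (WeightedSat d)}

/-- A problem is W[1]-hard if every problem in W[1] reduces to it. -/
def W1Hard (B : Problem) : Prop := ∀ A ∈ W1, Reduces A B

/-! ## Most vital edges for the minimum spanning tree -/

/-- The weight of a graph: the sum of the weights of its edges. -/
noncomputable def totalWeight {V : Type*} [Fintype V] (w : Sym2 V → ℕ) (T : SimpleGraph V) : ℕ :=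
  by classical exact ∑ e ∈ T.edgeFinset, w e

/-- The weight of a minimum spanning tree of `G`, which is infinite if `G` is disconnected. -/
noncomputable def mstWeight {V : Type*} [Fintype V] (G : SimpleGraph V) (w : Sym2 V → ℕ) : ℕ∞ :=
  ⨅ (T : SimpleGraph V) (_ : T ≤ G ∧ T.IsTree), (totalWeight w T : ℕ∞)

/-- An input of the most vital edges problem: a nonempty finite graph with nonnegative integral
edge weights (only the values of `weight` at edges of the graph matter), and positive integers `b`
and `r`. -/
structure MVEInput where
  n : ℕ
  n_pos : 0 < n
  graph : SimpleGraph (Fin n)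
  weight : Sym2 (Fin n) → ℕ
  b : ℕ
  b_pos : 0 < b
  r : ℕ
  r_pos : 0 < r

/-- There is a set `I` of at most `b` edges whose removal leaves a graph with minimum spanning tree
weight at least `r`. -/
def MVEInput.IsYes (M : MVEInput) : Prop :=
  ∃ I : Finset (Sym2 (Fin M.n)), (I : Set (Sym2 (Fin M.n))) ⊆ M.graph.edgeSet ∧
    I.card ≤ M.b ∧ (M.r : ℕ∞) ≤ mstWeight (M.graph.deleteEdges (I : Set (Sym2 (Fin M.n)))) M.weight

open Classical in
/-- The input is written as `b`, `r`, the number of vertices, and the weighted adjacency matrix row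
by row, with entry `0` for a non-edge and `w + 1` for an edge of weight `w`. -/
noncomputable def MVEInput.encode (M : MVEInput) : List ℕ :=
  M.b :: M.r :: M.n :: (List.finRange M.n).flatMap fun u => (List.finRange M.n).map fun v =>
    if M.graph.Adj u v then M.weight s(u, v) + 1 else 0

/-- The problem `b`-Most Vital Edges in MST, parameterized by the required weight `r`. -/
def MostVitalEdges : Problem :=
  {i | ∃ M : MVEInput, i.1 = M.encode ∧ i.2 = M.r ∧ M.IsYes}

end ParamComplexity

/-! A problem in W[1] reduces to weighted `d`-CNF satisfiability for some fixed `d`, so it suffices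
to follow such a reduction by one to `MostVitalEdges`. The second reduction passes through cliques.

Formulas to cliques (`Source.mem_weightedSat_iff_clique`). A variable is represented by the position
of its first occurrence. The `k` true variables then form an increasing sequence `s`, framed by `0`
and two numbers beyond all positions. A slot `(t, s t, s (t + 1))` records a true variable and the
fact that everything up to the next one is false. One slot suffices to falsify a literal, so `d`
slots suffice to exhibit a violated clause. The vertices are consistent `(d + 1)`-tuples of slots
that refute no clause, and the edges join tuples that agree. In a clique a tuple is determined by
its tuple of slot numbers. Hence a clique of size `(k + 2) ^ (d + 1)` realizes all tuples of
numbers, describes a single sequence `s`, and certifies every clause.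

Cliques to spanning trees (`exists_deletion_of_clique`, `clique_of_deletion`). Take a complete graph
with weights zero and one. Padding gives each of the `n` original vertices exactly `D` zero edges,
and the remaining vertices form a huge clique of weight zero. Now let `k` be the clique size. A
`k`-clique meets `k * D - k * (k - 1) / 2` zero edges; deleting them isolates its vertices and
forces weight `k`. Conversely, weight `k` forces `k + 1` components of zero edges. The huge clique
stays in one piece and the budget cannot detach `k + 1` vertices from it, so exactly `k` vertices
are cut off one by one, which is affordable only if they are pairwise adjacent. The required weight
is the clique size, a function of the old parameter and `d`.

Running time. The new instance is described entry by entry with nested sums of polynomial range, and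
`PC` is closed under these. Composition needs care: `t` steps can announce an output of length
exponential in `t`, as the length is only a number in a register. But few of its entries are nonzero
(`Exec.exists_support`), so a long output starts with a zero or soon shows two consecutive zeros.
Either is an empty clause, and a short scan rejects it. -/

namespace ParamComplexity

/-! ## Reasoning about programs -/

/-- The program halts within `T` steps in a state satisfying `Q`. -/
def Runs (p : Prog) (s : State) (Q : State → Prop) (T : ℕ) : Prop :=
  ∃ s' t, Exec p s s' t ∧ Q s' ∧ t ≤ T

theorem Runs.mono {p : Prog} {s : State} {Q Q' : State → Prop} {T T' : ℕ} (h : Runs p s Q T)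
    (hQ : ∀ s', Q s' → Q' s') (hT : T ≤ T') : Runs p s Q' T' := by
  obtain ⟨s', t, he, hq, ht⟩ := h
  exact ⟨s', t, he, hQ _ hq, ht.trans hT⟩

theorem Runs.seq {p q : Prog} {s : State} {Q Q' : State → Prop} {T T' : ℕ} (h : Runs p s Q T)
    (h' : ∀ s', Q s' → Runs q s' Q' T') : Runs (.seq p q) s Q' (T + T') := by
  obtain ⟨s', t, he, hq, ht⟩ := h
  obtain ⟨s'', t', he', hq', ht'⟩ := h' s' hq
  exact ⟨s'', t + t', he.seq he', hq', by omega⟩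

theorem Runs.assign {s : State} {Q : State → Prop} {x : ℕ} {e : Term}
    (h : Q (s.setReg x (e.val s))) : Runs (.assign x e) s Q (e.cost + 1) :=
  ⟨_, _, .assign s x e, h, le_rfl⟩

theorem Runs.store {s : State} {Q : State → Prop} {a : ℕ} {e₁ e₂ : Term}
    (h : Q (s.setCell a (e₁.val s) (e₂.val s))) :
    Runs (.store a e₁ e₂) s Q (e₁.cost + e₂.cost + 1) :=
  ⟨_, _, .store s a e₁ e₂, h, le_rfl⟩

theorem Runs.ite {s : State} {Q : State → Prop} {e : Term} {p q : Prog} {T : ℕ}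
    (h₁ : e.val s ≠ 0 → Runs p s Q T) (h₂ : e.val s = 0 → Runs q s Q T) :
    Runs (.ite e p q) s Q (e.cost + 1 + T) := by
  by_cases h : e.val s = 0
  · obtain ⟨s', t, he, hq, ht⟩ := h₂ h
    exact ⟨s', _, .ite_false h he, hq, by omega⟩
  · obtain ⟨s', t, he, hq, ht⟩ := h₁ h
    exact ⟨s', _, .ite_true h he, hq, by omega⟩

/-- The invariant carries the number of the round, and the total number `m` of rounds is known
beforehand; so induction on the rounds left replaces a termination measure. -/
theorem Runs.loop {e : Term} {p : Prog} {T m : ℕ} (I : ℕ → State → Prop)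
    (hstep : ∀ i < m, ∀ s, I i s → e.val s ≠ 0 ∧ Runs p s (I (i + 1)) T)
    (hdone : ∀ s, I m s → e.val s = 0) {s : State} (h : I 0 s) :
    Runs (.loop e p) s (I m) (m * (e.cost + 1 + T) + (e.cost + 1)) := by
  suffices H : ∀ j i, i + j = m → ∀ s, I i s →
      Runs (.loop e p) s (I m) (j * (e.cost + 1 + T) + (e.cost + 1)) from H m 0 (by simp) s h
  intro j
  induction j with
  | zero =>
    intro i hi s hs
    obtain rfl : i = m := by omega
    exact ⟨s, _, .loop_done (hdone s hs), hs, by omega⟩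
  | succ j ih =>
    intro i hi s hs
    obtain ⟨hne, s', t, he, hI, ht⟩ := hstep i (by omega) s hs
    obtain ⟨s'', t', he', hI', ht'⟩ := ih (i + 1) (by omega) s' hI
    exact ⟨s'', _, .loop_step hne he he', hI', by rw [Nat.succ_mul]; omega⟩

@[simp] theorem State.setReg_reg (s : State) (x v y : ℕ) :
    (s.setReg x v).reg y = if y = x then v else s.reg y := by
  simp [State.setReg, Function.update_apply]

@[simp] theorem State.setReg_arr (s : State) (x v : ℕ) : (s.setReg x v).arr = s.arr := rfl

@[simp] theorem State.setCell_reg (s : State) (a i v : ℕ) : (s.setCell a i v).reg = s.reg := rfl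

@[simp] theorem State.setCell_arr (s : State) (a i v b j : ℕ) :
    (s.setCell a i v).arr b j = if b = a ∧ j = i then v else s.arr b j := by
  by_cases hb : b = a
  · subst hb; simp [State.setCell, Function.update_apply]
  · simp [State.setCell, hb]

/-! ## Functions computable in polynomial time with nested bounded sums -/

/-- The encoded input and the parameter on which a computation works. -/
structure Source where
  list : List ℕ
  param : ℕ

/-- The quantity in which running times are measured. -/
def Source.width (i : Source) : ℕ := i.list.length + i.param + 3

/-- The entry at position `q`, zero beyond the end. -/
def Source.entry (i : Source) (q : ℕ) : ℕ := i.list.getD q 0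

/-- The state holds the input `i` in the first array, and the bound for sums in register `2`. -/
structure Loaded (e : ℕ) (s : State) (i : Source) : Prop where
  length : s.reg 0 = i.list.length
  param : s.reg 1 = i.param
  bound : s.reg 2 = i.width ^ e
  entry : ∀ j < i.list.length, s.arr 0 j = i.entry j

theorem Loaded.of_eq {e : ℕ} {s s' : State} {i : Source} (h : Loaded e s i)
    (ha : s'.arr = s.arr) (hr : ∀ x < 3, s'.reg x = s.reg x) : Loaded e s' i :=
  ⟨by rw [hr 0 (by simp), h.length], by rw [hr 1 (by simp), h.param],
    by rw [hr 2 (by simp), h.bound], by rw [ha]; exact h.entry⟩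

/-- The types of arguments: an input together with finitely many numbers. -/
class Context (α : Type) where
  source : α → Source
  var : α → ℕ → ℕ
  valid : ℕ → α → Prop

/-- Variables are numbered by all of `ℕ`, so the infinitely many unused ones need a value; the
parameter is convenient because register `1` always holds it. -/
instance : Context Source := ⟨id, fun i _ => i.param, fun _ _ => True⟩

/-- The newest variable has number `0` and shifts the others. Its bound is the range of the sum that
introduces it. -/
instance {α : Type} [Context α] : Context (α × ℕ) where
  source p := Context.source p.1
  var p x := Nat.casesOn x p.2 fun x => Context.var p.1 x
  valid e p := Context.valid e p.1 ∧ p.2 < (Context.source p.1).width ^ e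

open Context

/-- `f` is computed in polynomial time by a program that uses the registers from `n` on, where the
arguments are in the registers given by `σ`. -/
def PC {α : Type} [Context α] (e : ℕ) (f : α → ℕ) : Prop :=
  ∀ (σ : ℕ → ℕ) (n : ℕ), 3 ≤ n → (∀ x, σ x < n) → ∃ p c, ∀ (s : State) (a : α),
    Loaded e s (source a) → valid e a → (∀ x, s.reg (σ x) = var a x) →
    Runs p s (fun s' => s'.arr = s.arr ∧ (∀ x < n, s'.reg x = s.reg x) ∧ s'.reg n = f a)
      ((source a).width ^ c)

theorem Source.two_le_width (i : Source) : 2 ≤ i.width := by unfold Source.width; omega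

/-- Since the width is at least two, powers of it absorb sums and, by `le_pow_self`, constants. Time
bounds are therefore tracked only through the existence of an exponent. -/
theorem add_pow_le {w : ℕ} (hw : 2 ≤ w) (a b : ℕ) : w ^ a + w ^ b ≤ w ^ (a + b + 1) := by
  have h1 : w ^ a ≤ w ^ (a + b) := Nat.pow_le_pow_right (by omega) (by omega)
  have h2 : w ^ b ≤ w ^ (a + b) := Nat.pow_le_pow_right (by omega) (by omega)
  rw [pow_succ]; nlinarith [Nat.mul_le_mul_left (w ^ (a + b)) hw]

theorem le_pow_self {w : ℕ} (hw : 2 ≤ w) (a : ℕ) : a ≤ w ^ a :=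
  (Nat.lt_pow_self (by omega)).le

/-! ### Closure properties of polynomial-time functions -/

section closure
variable {α : Type} [Context α] {e : ℕ} {f g h : α → ℕ}

theorem PC.congr (hf : PC e f) (H : ∀ a, valid e a → g a = f a) : PC e g := by
  intro σ n hn hσ
  obtain ⟨p, c, hp⟩ := hf σ n hn hσ
  refine ⟨p, c, fun s a hl hv hs => ?_⟩
  rw [H a hv]; exact hp s a hl hv hs

theorem PC.of_term (t : (ℕ → ℕ) → Term)
    (ht : ∀ σ s a, Loaded e s (source a) → (∀ x, s.reg (σ x) = var a x) → (t σ).val s = f a) :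
    PC e f := by
  intro σ n hn hσ
  refine ⟨.assign n (t σ), (t σ).cost + 1, fun s a hl hv hs => ?_⟩
  refine (Runs.assign ?_).mono (fun _ h => h) (le_pow_self (source a).two_le_width _)
  refine ⟨rfl, fun x hx => ?_, ?_⟩
  · simp [hx.ne]
  · simp [ht σ s a hl hs]

theorem PC.const (c : ℕ) : PC e fun _ : α => c := .of_term (fun _ => .const c) fun _ _ _ _ _ => rfl

theorem PC.length : PC e fun a : α => (source a).list.length :=
  .of_term (fun _ => .reg 0) fun _ _ _ h _ => h.length

theorem PC.param : PC e fun a : α => (source a).param :=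
  .of_term (fun _ => .reg 1) fun _ _ _ h _ => h.param

theorem PC.snd : PC e fun a : α × ℕ => a.2 :=
  .of_term (fun σ => .reg (σ 0)) fun _ _ _ _ h => h 0

theorem PC.comp_fst (hf : PC e f) : PC e fun a : α × ℕ => f a.1 := by
  intro σ n hn hσ
  obtain ⟨p, c, hp⟩ := hf (fun x => σ (x + 1)) n hn fun x => hσ _
  exact ⟨p, c, fun s a hl hv hs => hp s a.1 hl hv.1 fun x => hs (x + 1)⟩

theorem Runs.then_assign {n c' : ℕ} {p : Prog} {Q : State → Prop} {s : State} {i : Source}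
    {t : Term}
    (h : Runs p s (fun s' => Q (s'.setReg n (t.val s'))) (i.width ^ c')) :
    Runs (.seq p (.assign n t)) s Q (i.width ^ (c' + (t.cost + 1) + 1)) :=
  (h.seq fun _ hs' => .assign hs').mono (fun _ h => h)
    ((Nat.add_le_add_left (le_pow_self i.two_le_width _) _).trans
      (add_pow_le i.two_le_width _ _))

/-- Two values are computed one after the other and then combined by a single expression. -/
theorem PC.map₂ (op : ℕ → ℕ → ℕ) (t : ℕ → Term)
    (ht : ∀ n s, (t n).val s = op (s.reg n) (s.reg (n + 1))) (hf : PC e f) (hg : PC e g) :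
    PC e fun a => op (f a) (g a) := by
  intro σ n hn hσ
  obtain ⟨p, c, hp⟩ := hf σ n hn hσ
  obtain ⟨q, d, hq⟩ := hg σ (n + 1) (by omega) fun x => (hσ x).trans (by omega)
  refine ⟨.seq (.seq p q) (.assign n (t n)), c + d + 1 + ((t n).cost + 1) + 1,
    fun s a hl hva hs => ?_⟩
  refine Runs.then_assign (c' := c + d + 1)
    (((hp s a hl hva hs).seq fun s' hs' => ?_).mono (fun _ h => h)
    (add_pow_le (source a).two_le_width c d))
  obtain ⟨h1, h2, h3⟩ := hs'
  refine (hq s' a (hl.of_eq h1 fun x hx => h2 x (by omega)) hva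
    fun x => (h2 _ (hσ x)).trans (hs x)).mono ?_ le_rfl
  rintro s'' ⟨h4, h5, h6⟩
  refine ⟨h4.trans h1, fun x hx => ?_, ?_⟩
  · simp [hx.ne, (h5 x (by omega)).trans (h2 x hx)]
  · simp [ht, h6, h5 n (by omega), h3]

theorem PC.add (hf : PC e f) (hg : PC e g) : PC e fun a => f a + g a :=
  .map₂ (· + ·) (fun n => .add (.reg n) (.reg (n + 1))) (fun _ _ => rfl) hf hg

theorem PC.sub (hf : PC e f) (hg : PC e g) : PC e fun a => f a - g a :=
  .map₂ (· - ·) (fun n => .sub (.reg n) (.reg (n + 1))) (fun _ _ => rfl) hf hg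

theorem PC.half (hf : PC e f) : PC e fun a => f a / 2 :=
  .map₂ (fun x _ => x / 2) (fun n => .half (.reg n)) (fun _ _ => rfl) hf hf

theorem PC.ite (hh : PC e h) (hf : PC e f) (hg : PC e g) :
    PC e fun a => if h a = 0 then g a else f a := by
  intro σ n hn hσ
  obtain ⟨r, b, hr⟩ := hh σ n hn hσ
  obtain ⟨p, c, hp⟩ := hf σ n hn hσ
  obtain ⟨q, d, hq⟩ := hg σ n hn hσ
  refine ⟨.seq r (.ite (.reg n) p q), b + (2 + (c + d + 1) + 1) + 1, fun s a hl hva hs => ?_⟩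
  have hw := (source a).two_le_width
  refine ((hr s a hl hva hs).seq fun s' hs' => ?_).mono (fun _ h => h) (add_pow_le hw _ _)
  obtain ⟨h1, h2, h3⟩ := hs'
  have hl' : Loaded e s' (source a) := hl.of_eq h1 fun x hx => h2 x (by omega)
  have hs' : ∀ x, s'.reg (σ x) = var a x := fun x => (h2 _ (hσ x)).trans (hs x)
  have hcd := add_pow_le hw c d
  refine (Runs.ite (T := (source a).width ^ (c + d + 1)) (fun hne => ?_) fun heq => ?_).mono
    (fun _ h => h) ((Nat.add_le_add_right (le_pow_self hw 2) _).trans (add_pow_le hw _ _))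
  · have : h a ≠ 0 := by rw [← h3]; exact hne
    refine (hp s' a hl' hva hs').mono ?_ (by omega)
    rintro s'' ⟨h4, h5, h6⟩
    exact ⟨h4.trans h1, fun x hx => (h5 x hx).trans (h2 x hx), by simp [this, h6]⟩
  · have : h a = 0 := by rw [← h3]; exact heq
    refine (hq s' a hl' hva hs').mono ?_ (by omega)
    rintro s'' ⟨h4, h5, h6⟩
    exact ⟨h4.trans h1, fun x hx => (h5 x hx).trans (h2 x hx), by simp [this, h6]⟩

/-- Cells beyond the announced length may hold leftovers of an earlier computation, so the index is
compared with the length before the cell is read. -/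
theorem PC.entry (hf : PC e f) : PC e fun a => (source a).entry (f a) := by
  intro σ n hn hσ
  obtain ⟨p, c, hp⟩ := hf σ n hn hσ
  refine ⟨.seq p (.ite (.sub (.reg 0) (.reg n)) (.assign n (.cell 0 (.reg n)))
    (.assign n (.const 0))), c + 7 + 1, fun s a hl hva hs => ?_⟩
  have hw := (source a).two_le_width
  refine ((hp s a hl hva hs).seq (T' := 7) fun s' hs' => ?_).mono (fun _ h => h)
    ((Nat.add_le_add_left (le_pow_self hw _) _).trans (add_pow_le hw _ _))
  obtain ⟨h1, h2, h3⟩ := hs'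
  have h0 : s'.reg 0 = (source a).list.length := (h2 0 (by omega)).trans hl.length
  refine (Runs.ite (T := 3) (fun hne => ?_) fun heq => ?_).mono (fun _ h => h)
    (by simp [Term.cost])
  · refine .assign ⟨h1, fun x hx => by simp [hx.ne, h2 x hx], ?_⟩
    simp only [Term.val, h0, h3] at hne
    simp [Term.val, h3, h1, hl.entry (f a) (by omega)]
  · refine (Runs.assign ⟨h1, fun x hx => by simp [hx.ne, h2 x hx], ?_⟩).mono (fun _ h => h)
      (by simp [Term.cost])
    simp only [Term.val, h0, h3] at heq
    simp [Term.val, Source.entry, List.getElem?_eq_none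
      (show (source a).list.length ≤ f a by omega)]

/-- This is the only loop in the calculus of `PC`. Register `n` is the counter and at the same time
the new variable, register `n + 1` accumulates, and the summand is computed from register `n + 2`
on. -/
theorem PC.sum {f : α × ℕ → ℕ} (hf : PC e f) :
    PC e fun a => ∑ i ∈ Finset.range ((source a).width ^ e), f (a, i) := by
  intro σ n hn hσ
  obtain ⟨p, c, hp⟩ := hf (fun x => Nat.casesOn x n σ) (n + 2) (by omega) (by
    intro x; cases x with
    | zero => simp
    | succ x => exact (hσ x).trans (by omega))
  refine ⟨.seq (.assign n (.const 0)) (.seq (.assign (n + 1) (.const 0)) (.seq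
    (.loop (.sub (.reg 2) (.reg n)) (.seq p (.seq
      (.assign (n + 1) (.add (.reg (n + 1)) (.reg (n + 2))))
      (.assign n (.add (.reg n) (.const 1))))))
    (.assign n (.reg (n + 1))))), e + (12 + c + 1) + 10 + 1, fun s a hl hva hs => ?_⟩
  have hw := (source a).two_le_width
  set M := (source a).width ^ e with hM
  let I : ℕ → State → Prop := fun i s' => s'.arr = s.arr ∧ (∀ x < n, s'.reg x = s.reg x) ∧
    s'.reg n = i ∧ s'.reg (n + 1) = ∑ j ∈ Finset.range i, f (a, j)
  have key : Runs (.loop (.sub (.reg 2) (.reg n)) (.seq p (.seq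
      (.assign (n + 1) (.add (.reg (n + 1)) (.reg (n + 2))))
      (.assign n (.add (.reg n) (.const 1)))))) ((s.setReg n 0).setReg (n + 1) 0)
      (I M) (M * (4 + ((source a).width ^ c + (4 + 4))) + 4) := by
    refine Runs.loop I (fun i hi s' hI => ?_) (fun s' hI => ?_) ?_
    · obtain ⟨h1, h2, h3, h4⟩ := hI
      have hl' : Loaded e s' (source a) := hl.of_eq h1 fun x hx => h2 x (by omega)
      refine ⟨by simp only [Term.val, hl'.bound, h3]; omega, ?_⟩
      refine (hp s' (a, i) hl' ⟨hva, hi⟩ ?_).seq fun s'' hs'' => ?_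
      · intro x; cases x with
        | zero => exact h3
        | succ x => exact (h2 _ (hσ x)).trans (hs x)
      · obtain ⟨h5, h6, h7⟩ := hs''
        refine .seq (.assign (Q := fun s => s = _) rfl) ?_
        rintro _ rfl
        refine .assign ⟨h5.trans h1, fun x hx => ?_, ?_, ?_⟩
        · simp [hx.ne, show x ≠ n + 1 by omega, h6 x (by omega), h2 x hx]
        · simp [Term.val, h6 n (by omega), h3]
        · simp [Term.val, h7, h6 (n + 1) (by omega), h4, Finset.sum_range_succ]
    · simp only [Term.val, hl.bound, (hI.2.1 2 (by omega)), hI.2.2.1]; omega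
    · refine ⟨rfl, fun x hx => ?_, by simp, by simp⟩
      simp [hx.ne, show x ≠ n + 1 by omega]
  refine (Runs.seq (.assign (Q := fun s' => s' = s.setReg n 0) rfl) (?_ : ∀ _, _ → Runs _ _ _
    (2 + (M * (4 + ((source a).width ^ c + (4 + 4))) + 4 + 2)))).mono (fun _ h => h) ?_
  · rintro _ rfl
    refine Runs.seq (.assign (Q := fun s' => s' = (s.setReg n 0).setReg (n + 1) 0) rfl) ?_
    rintro _ rfl
    refine key.seq ?_
    rintro s' ⟨h1, h2, h3, h4⟩
    refine .assign ⟨h1, fun x hx => by simp [hx.ne, h2 x hx], by simp [Term.val, h4, M]⟩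
  · have h1 : 12 + (source a).width ^ c ≤ (source a).width ^ (12 + c + 1) :=
      (Nat.add_le_add_right (le_pow_self hw 12) _).trans (add_pow_le hw _ _)
    have h2 : M * (12 + (source a).width ^ c) ≤ (source a).width ^ (e + (12 + c + 1)) := by
      rw [pow_add]; exact Nat.mul_le_mul_left _ h1
    have h3 := (Nat.add_le_add h2 (le_pow_self hw 10)).trans (add_pow_le hw _ _)
    refine le_trans ?_ h3
    simp only [Term.cost]
    have : 4 + ((source a).width ^ c + (4 + 4)) = 12 + (source a).width ^ c := by omega
    rw [this]; omega

end closure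

/-- The number `1` if `P` holds and `0` otherwise. -/
noncomputable def ind (P : Prop) : ℕ := by classical exact if P then 1 else 0

theorem ind_of {P : Prop} (h : P) : ind P = 1 := by simp [ind, h]

theorem ind_of_not {P : Prop} (h : ¬P) : ind P = 0 := by simp [ind, h]

theorem ind_eq_zero {P : Prop} : ind P = 0 ↔ ¬P := by
  by_cases h : P <;> simp [ind, h]

/-- A predicate that is decided in polynomial time with nested bounded sums. -/
def PP {α : Type} [Context α] (e : ℕ) (P : α → Prop) : Prop := PC e fun a => ind (P a)

/-! ### Predicates, bounded quantifiers and derived arithmetic -/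

section closure
variable {α : Type} [Context α] {e : ℕ} {f g : α → ℕ} {P Q : α → Prop}

theorem PP.congr (hP : PP e P) (H : ∀ a, valid e a → (Q a ↔ P a)) : PP e Q :=
  PC.congr hP fun a ha => by rw [H a ha]

theorem PP.cond (hP : PP e P) (hf : PC e f) (hg : PC e g) [∀ a, Decidable (P a)] :
    PC e fun a => if P a then f a else g a :=
  (PC.ite hP hf hg).congr fun a _ => by by_cases h : P a <;> simp [h, ind]

theorem PP.not (hP : PP e P) : PP e fun a => ¬P a :=
  ((PC.const 1).sub hP).congr fun a _ => by by_cases h : P a <;> simp [h, ind]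

theorem PP.and (hP : PP e P) (hQ : PP e Q) : PP e fun a => P a ∧ Q a :=
  (PC.ite hP hQ (.const 0)).congr fun a _ => by
    by_cases h : P a <;> by_cases h' : Q a <;> simp [h, h', ind]

theorem PP.or (hP : PP e P) (hQ : PP e Q) : PP e fun a => P a ∨ Q a :=
  (hP.not.and hQ.not).not.congr fun a _ => by tauto

theorem PP.imp (hP : PP e P) (hQ : PP e Q) : PP e fun a => P a → Q a :=
  (hP.not.or hQ).congr fun a _ => by tauto

theorem PP.le (hf : PC e f) (hg : PC e g) : PP e fun a => f a ≤ g a :=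
  ((PC.const 1).sub (hf.sub hg)).congr fun a _ => by
    by_cases h : f a ≤ g a
    · simp [ind_of h, Nat.sub_eq_zero_of_le h]
    · rw [ind_of_not h]; omega

theorem PP.lt (hf : PC e f) (hg : PC e g) : PP e fun a => f a < g a :=
  (PP.le (hf.add (.const 1)) hg).congr fun a _ => by simp

theorem PP.eq (hf : PC e f) (hg : PC e g) : PP e fun a => f a = g a :=
  ((PP.le hf hg).and (PP.le hg hf)).congr fun a _ => by omega

theorem PP.ne (hf : PC e f) (hg : PC e g) : PP e fun a => f a ≠ g a := (PP.eq hf hg).not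

/-- A bounded existential holds when a sum of indicators is nonzero; `hM` ensures that the fixed
range of the sum covers all candidates. -/
theorem PP.existsLt {P : α → ℕ → Prop} (hP : PP e fun a : α × ℕ => P a.1 a.2) (hf : PC e f)
    (hM : ∀ a, valid e a → f a ≤ (source a).width ^ e) : PP e fun a => ∃ i < f a, P a i :=
  (PP.ne (PC.sum ((PP.lt PC.snd hf.comp_fst).and hP)) (.const 0)).congr fun a ha => by
    simp only [ne_eq, Finset.sum_eq_zero_iff, Finset.mem_range, ind_eq_zero]
    push Not
    exact ⟨fun ⟨i, h, h'⟩ => ⟨i, h.trans_le (hM a ha), h, h'⟩, fun ⟨i, _, h⟩ => ⟨i, h⟩⟩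

theorem PP.forallLt {P : α → ℕ → Prop} (hP : PP e fun a : α × ℕ => P a.1 a.2) (hf : PC e f)
    (hM : ∀ a, valid e a → f a ≤ (source a).width ^ e) : PP e fun a => ∀ i < f a, P a i :=
  (PP.existsLt (P := fun a i => ¬P a i) hP.not hf hM).not.congr fun a _ => by push Not; rfl

theorem PP.true : PP e fun _ : α => True :=
  (PC.const 1).congr fun _ _ => ind_of trivial

/-- Here `m` does not depend on the input, so the conjunction is unrolled in the program and `P j`
may be treated differently for each `j`. -/
theorem PP.forallConst {P : ℕ → α → Prop} (m : ℕ) (hP : ∀ j < m, PP e (P j)) :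
    PP e fun a => ∀ j < m, P j a := by
  induction m with
  | zero => exact PP.true.congr fun a _ => by simp
  | succ m ih =>
    exact ((ih fun j hj => hP j (by omega)).and (hP m (by omega))).congr fun a _ =>
      Nat.forall_lt_succ_right

theorem PP.existsConst {P : ℕ → α → Prop} (m : ℕ) (hP : ∀ j < m, PP e (P j)) :
    PP e fun a => ∃ j < m, P j a :=
  (PP.forallConst m fun j hj => (hP j hj).not).not.congr fun a _ => by push Not; rfl

/-- The machine cannot multiply: the product is obtained by summing `g a` over all `i < f a`. -/
theorem PC.mul (hf : PC e f) (hg : PC e g)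
    (hM : ∀ a, valid e a → f a ≤ (source a).width ^ e) : PC e fun a => f a * g a := by
  classical
  refine (PC.sum (PP.cond (PP.lt PC.snd hf.comp_fst) hg.comp_fst (.const 0))).congr fun a ha => ?_
  dsimp only
  rw [← Finset.sum_filter, Finset.sum_const, smul_eq_mul]
  have : (Finset.range ((source a).width ^ e)).filter (fun i => i < f a) = Finset.range (f a) := by
    ext i; simp only [Finset.mem_filter, Finset.mem_range]; have := hM a ha; omega
  simp only [this, Finset.card_range]

theorem PC.pow (hf : PC e f) (m : ℕ) (hM : ∀ a, valid e a → f a ≤ (source a).width ^ e) :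
    PC e fun a => f a ^ m := by
  induction m with
  | zero => exact (PC.const 1).congr fun a _ => by simp
  | succ m ih => exact (PC.mul hf ih hM).congr fun a _ => pow_succ' _ _

/-- The quotient is the number of `i` with `(i + 1) * g a ≤ f a`. -/
theorem PC.div (hf : PC e f) (hg : PC e g) (hM : ∀ a, valid e a → f a ≤ (source a).width ^ e)
    (hpos : ∀ a, valid e a → 0 < g a) : PC e fun a => f a / g a := by
  refine (PC.sum (PP.le (PC.mul (PC.snd.add (.const 1)) hg.comp_fst fun a ha => ha.2)
    hf.comp_fst)).congr fun a ha => ?_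
  have h : ∀ i, ind ((i + 1) * g a ≤ f a) = if i < f a / g a then 1 else 0 := fun i => by
    have := Nat.le_div_iff_mul_le (x := i + 1) (y := f a) (hpos a ha)
    by_cases hi : i < f a / g a
    · rw [if_pos hi, ind_of (this.1 hi)]
    · rw [if_neg hi, ind_of_not fun H => hi (this.2 H)]
  simp only [h]
  rw [← Finset.sum_filter, Finset.sum_const, smul_eq_mul, mul_one]
  have : (Finset.range ((source a).width ^ e)).filter (fun i => i < f a / g a) =
      Finset.range (f a / g a) := by
    ext i
    simp only [Finset.mem_filter, Finset.mem_range]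
    have := hM a ha; have := Nat.div_le_self (f a) (g a); omega
  rw [this, Finset.card_range]

theorem PC.mod (hf : PC e f) (hg : PC e g) (hM : ∀ a, valid e a → f a ≤ (source a).width ^ e)
    (hM' : ∀ a, valid e a → g a ≤ (source a).width ^ e)
    (hpos : ∀ a, valid e a → 0 < g a) : PC e fun a => f a % g a :=
  (hf.sub (PC.mul hg (PC.div hf hg hM hpos) hM')).congr fun a _ => by
    have := Nat.mod_add_div (f a) (g a); omega

theorem PC.width : PC e fun a : α => (source a).width :=
  (PC.length.add PC.param).add (.const 3)

end closure

/-! ## Formulas, read from their codes -/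

namespace Source

/-- The entries at positions `p` and `q` are literals of the same variable. -/
def SameVar (i : Source) (p q : ℕ) : Prop :=
  i.entry p ≠ 0 ∧ i.entry q ≠ 0 ∧ (i.entry p - 1) / 2 = (i.entry q - 1) / 2

/-- Position `p` is the first occurrence of a variable. -/
def First (i : Source) (p : ℕ) : Prop :=
  i.entry p ≠ 0 ∧ ∀ q < i.list.length, q < p → ¬i.SameVar q p

/-- The literal at position `q` is false if the first occurrences of true variables include
position `a - 1` (for positive `a`), and no position between `a - 1` and `b - 1`. -/
def Falsified (i : Source) (a b q : ℕ) : Prop :=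
  (i.entry q % 2 = 1 ∧ ∃ p < i.list.length, i.First p ∧ i.SameVar p q ∧ a < p + 1 ∧ p + 1 < b) ∨
    (i.entry q % 2 = 0 ∧ 0 < a ∧ i.SameVar (a - 1) q)

/-- The input is not the code of a formula with at most `d` literals in every clause. -/
def Malformed (i : Source) (d : ℕ) : Prop :=
  (0 < i.list.length ∧ i.entry (i.list.length - 1) ≠ 0) ∨
    ∃ q < i.list.length, ∀ j < d + 1, i.entry (q + j) ≠ 0

/-- The values `a` and `b` are admissible for two consecutive members with numbers `t` and `t + 1`
of the increasing sequence made up of zero, the successors of the first positions of the `k` true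
variables, and two numbers beyond all positions. -/
def SlotOk (i : Source) (t a b : ℕ) : Prop :=
  t ≤ i.param + 1 ∧ a < b ∧ b ≤ i.list.length + 2 ∧ (t = 0 → a = 0) ∧
    (0 < t → t ≤ i.param → 0 < a ∧ i.First (a - 1)) ∧ (t = i.param + 1 → a = i.list.length + 1)

/-- The digits of `v` to the base `i.width`. -/
def digit (i : Source) (m v : ℕ) : ℕ := v / i.width ^ m % i.width

/-- Agreement of the slots of `u` and `v` with numbers `j` and `l`. -/
def Link (i : Source) (j l u v : ℕ) : Prop :=
  (i.digit (3 * j) u = i.digit (3 * l) v → i.digit (3 * j + 1) u = i.digit (3 * l + 1) v ∧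
    i.digit (3 * j + 2) u = i.digit (3 * l + 2) v) ∧
  (i.digit (3 * j) u + 1 = i.digit (3 * l) v → i.digit (3 * j + 2) u = i.digit (3 * l + 1) v)

/-- Agreement of all slots of `u` and `v`. -/
def Compat (i : Source) (d u v : ℕ) : Prop := ∀ j < d + 1, ∀ l < d + 1, i.Link j l u v

/-- Some clause has only literals that are falsified by slots of `v`. -/
def Refuted (i : Source) (d v : ℕ) : Prop :=
  ∃ z < i.list.length, i.entry z = 0 ∧ ∀ q < i.list.length, q < z →
    (∃ y < i.list.length, y < z ∧ q ≤ y ∧ i.entry y = 0) ∨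
      ∃ j < d + 1, i.Falsified (i.digit (3 * j + 1) v) (i.digit (3 * j + 2) v) q

/-- The number `v` codes a tuple of slots compatible with the formula. -/
def Node (i : Source) (d v : ℕ) : Prop :=
  ¬i.Malformed d ∧ i.Compat d v v ∧
    (∀ j < d + 1, i.SlotOk (i.digit (3 * j) v) (i.digit (3 * j + 1) v) (i.digit (3 * j + 2) v)) ∧
    ¬i.Refuted d v

/-- The number of codes of tuples of slots. -/
def order (i : Source) (d : ℕ) : ℕ := i.width ^ (3 * (d + 1))

/-- The graph of compatible tuples of slots. -/
def Adj (i : Source) (d u v : ℕ) : Prop :=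
  u < i.order d ∧ v < i.order d ∧ u ≠ v ∧ i.Node d u ∧ i.Node d v ∧ i.Compat d u v ∧ i.Compat d v u

/-- The size of the cliques to be found. -/
def cliqueSize (i : Source) (d : ℕ) : ℕ := (i.param + 2) ^ (d + 1)

end Source

/-- The edges of weight zero: those of the graph `adj` on the numbers below `n`, edges that
pad the degree of each of these numbers to `D`, and those between numbers from `n` on. -/
def ZeroEdge (n D : ℕ) (adj : ℕ → ℕ → Prop) (u v : ℕ) : Prop :=
  adj u v ∨ (u < n ∧ n ≤ v ∧ v < n + D ∧ ¬adj u (v - n)) ∨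
    (v < n ∧ n ≤ u ∧ u < n + D ∧ ¬adj v (u - n)) ∨ (n ≤ u ∧ n ≤ v)

/-- The number of edges to be removed in order to isolate a clique of size `k`. -/
def budget (D k : ℕ) : ℕ := k * D - k * (k - 1) / 2

namespace Source

/-- The number of vertices of the most vital edges instance. -/
def vertices (i : Source) (d : ℕ) : ℕ := i.order d ^ 5

/-- The adjacency matrix of the most vital edges instance. -/
noncomputable def matrix (i : Source) (d u v : ℕ) : ℕ := by
  classical
  exact if u = v then 0 else
    if ZeroEdge (i.order d) (i.order d ^ 3) (i.Adj d) u v then 1 else 2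

/-- The code of the most vital edges instance, entry by entry. -/
noncomputable def output (i : Source) (d j : ℕ) : ℕ :=
  if j = 0 then budget (i.order d ^ 3) (i.cliqueSize d) else if j = 1 then i.cliqueSize d else
    if j = 2 then i.vertices d else
      i.matrix d ((j - 3) / i.vertices d) ((j - 3) % i.vertices d)

/-- The length of the code of the most vital edges instance. -/
def outputLength (i : Source) (d : ℕ) : ℕ := i.vertices d * i.vertices d + 3

end Source

/-- An exponent such that all loops of the construction are bounded by that power. -/
def loopExp (d : ℕ) : ℕ := 30 * (d + 1) + 2

/-! ### Size bounds for the construction -/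

namespace Source
theorem one_le_width (i : Source) : 1 ≤ i.width := by unfold width; omega

theorem width_le (i : Source) (d : ℕ) : i.width ≤ i.width ^ loopExp d :=
  Nat.le_self_pow (by simp [loopExp]) _

theorem length_le (i : Source) (d : ℕ) : i.list.length ≤ i.width ^ loopExp d :=
  le_trans (by unfold width; omega) (i.width_le d)

theorem two_le_order (i : Source) (d : ℕ) : 2 ≤ i.order d :=
  i.two_le_width.trans (Nat.le_self_pow (by simp) _)

theorem order_pow (i : Source) (d m : ℕ) : i.order d ^ m = i.width ^ (3 * (d + 1) * m) :=
  (pow_mul _ _ _).symm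

theorem order_pow_le (i : Source) (d : ℕ) {m : ℕ} (hm : m ≤ 10) :
    i.order d ^ m ≤ i.width ^ loopExp d := by
  rw [order_pow]
  exact Nat.pow_le_pow_right i.one_le_width (by unfold loopExp; nlinarith)

theorem order_le (i : Source) (d : ℕ) : i.order d ≤ i.width ^ loopExp d := by
  simpa using i.order_pow_le d (m := 1) (by simp)

theorem cliqueSize_le_order (i : Source) (d : ℕ) : i.cliqueSize d ≤ i.order d := by
  unfold cliqueSize order
  calc (i.param + 2) ^ (d + 1) ≤ i.width ^ (d + 1) :=
        Nat.pow_le_pow_left (by unfold width; omega) _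
    _ ≤ _ := Nat.pow_le_pow_right i.one_le_width (by omega)

theorem cliqueSize_le (i : Source) (d : ℕ) : i.cliqueSize d ≤ i.width ^ loopExp d :=
  (i.cliqueSize_le_order d).trans (i.order_le d)

theorem vertices_le (i : Source) (d : ℕ) : i.vertices d ≤ i.width ^ loopExp d :=
  i.order_pow_le d (by simp)

theorem vertices_pos (i : Source) (d : ℕ) : 0 < i.vertices d :=
  Nat.pow_pos (by have := i.two_le_order d; omega)

/-- This explains `loopExp`: the matrix has `order ^ 10 = width ^ (30 * (d + 1))` entries, and two
further factors of the width absorb the three leading numbers. -/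
theorem outputLength_le (i : Source) (d : ℕ) : i.outputLength d ≤ i.width ^ loopExp d := by
  have h1 : i.vertices d * i.vertices d = i.width ^ (30 * (d + 1)) := by
    unfold vertices; rw [← pow_add, order_pow]; congr 1; ring
  have hw : 3 ≤ i.width := by unfold width; omega
  have h2 : 1 ≤ i.width ^ (30 * (d + 1)) := Nat.one_le_pow _ _ i.one_le_width
  unfold outputLength loopExp
  rw [h1, pow_add]
  nlinarith [Nat.pow_le_pow_left hw 2]

end Source

/-! ### The construction is computable in polynomial time -/

section construction
variable {α : Type} [Context α] {e d : ℕ} {f g h : α → ℕ}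

theorem PP.sameVar (hf : PC e f) (hg : PC e g) : PP e fun a => (source a).SameVar (f a) (g a) :=
  (PP.ne hf.entry (.const 0)).and ((PP.ne hg.entry (.const 0)).and
    (PP.eq (hf.entry.sub (.const 1)).half (hg.entry.sub (.const 1)).half))

theorem PP.first (hf : PC (loopExp d) f) : PP (loopExp d) fun a => (source a).First (f a) :=
  (PP.ne hf.entry (.const 0)).and (PP.forallLt
    (P := fun a q => q < f a → ¬(source a).SameVar q (f a))
    ((PP.lt PC.snd hf.comp_fst).imp (PP.sameVar (α := α × ℕ) PC.snd hf.comp_fst).not)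
    PC.length fun _ _ => Source.length_le _ _)

theorem PC.mod_two (hf : PC e f) : PC e fun a => f a % 2 :=
  (hf.sub (hf.half.add hf.half)).congr fun a _ => by omega

theorem PP.falsified (hf : PC (loopExp d) f) (hg : PC (loopExp d) g) (hh : PC (loopExp d) h) :
    PP (loopExp d) fun a => (source a).Falsified (f a) (g a) (h a) := by
  refine ((PP.eq hh.entry.mod_two (.const 1)).and (PP.existsLt
    (P := fun a p => (source a).First p ∧ (source a).SameVar p (h a) ∧ f a < p + 1 ∧ p + 1 < g a)
    ?_ PC.length fun _ _ => Source.length_le _ _)).or ((PP.eq hh.entry.mod_two (.const 0)).and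
    ((PP.lt (.const 0) hf).and (PP.sameVar (hf.sub (.const 1)) hh)))
  exact (PP.first (α := α × ℕ) PC.snd).and ((PP.sameVar (α := α × ℕ) PC.snd hh.comp_fst).and
    ((PP.lt hf.comp_fst (PC.snd.add (.const 1))).and (PP.lt (PC.snd.add (.const 1)) hg.comp_fst)))

theorem PP.malformed (m : ℕ) : PP (loopExp d) fun a : α => (source a).Malformed m := by
  refine ((PP.lt (.const 0) PC.length).and (PP.ne (PC.length.sub (.const 1)).entry (.const 0))).or
    (PP.existsLt (P := fun a q => ∀ j < m + 1, (source a).entry (q + j) ≠ 0) ?_ PC.length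
      fun _ _ => Source.length_le _ _)
  exact PP.forallConst (α := α × ℕ) _ fun j _ => PP.ne (PC.snd.add (.const j)).entry (.const 0)

theorem PP.slotOk (hf : PC (loopExp d) f) (hg : PC (loopExp d) g) (hh : PC (loopExp d) h) :
    PP (loopExp d) fun a => (source a).SlotOk (f a) (g a) (h a) :=
  (PP.le hf (PC.param.add (.const 1))).and ((PP.lt hg hh).and
    ((PP.le hh (PC.length.add (.const 2))).and
    (((PP.eq hf (.const 0)).imp (PP.eq hg (.const 0))).and
    (((PP.lt (.const 0) hf).imp ((PP.le hf PC.param).imp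
      ((PP.lt (.const 0) hg).and (PP.first (hg.sub (.const 1)))))).and
    ((PP.eq hf (PC.param.add (.const 1))).imp (PP.eq hg (PC.length.add (.const 1))))))))

/-- The values of `f` are bounded by the number of rounds of a loop. -/
def Small (e : ℕ) (f : α → ℕ) : Prop := ∀ a, valid e a → f a ≤ (source a).width ^ e

theorem PC.digit (hf : PC (loopExp d) f) (hs : Small (loopExp d) f) (m : ℕ) :
    PC (loopExp d) fun a => (source a).digit m (f a) :=
  have hw : ∀ a : α, valid (loopExp d) a → (source a).width ≤ (source a).width ^ loopExp d :=
    fun _ _ => Source.width_le _ _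
  PC.mod (PC.div hf (PC.pow PC.width m hw) hs fun a _ => Nat.pow_pos (source a).one_le_width)
    PC.width (fun a ha => (Nat.div_le_self _ _).trans (hs a ha)) hw fun a _ =>
    (source a).one_le_width

theorem PP.compat (hf : PC (loopExp d) f) (hg : PC (loopExp d) g) (hsf : Small (loopExp d) f)
    (hsg : Small (loopExp d) g) (m : ℕ) :
    PP (loopExp d) fun a => (source a).Compat m (f a) (g a) :=
  PP.forallConst _ fun _ _ => PP.forallConst _ fun _ _ =>
    ((PP.eq (hf.digit hsf _) (hg.digit hsg _)).imp ((PP.eq (hf.digit hsf _) (hg.digit hsg _)).and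
      (PP.eq (hf.digit hsf _) (hg.digit hsg _)))).and
    ((PP.eq ((hf.digit hsf _).add (.const 1)) (hg.digit hsg _)).imp
      (PP.eq (hf.digit hsf _) (hg.digit hsg _)))

theorem PP.refuted (hf : PC (loopExp d) f) (hsf : Small (loopExp d) f) (m : ℕ) :
    PP (loopExp d) fun a => (source a).Refuted m (f a) := by
  have hN : ∀ (β : Type) [Context β] (a : β), valid (loopExp d) a →
    (source a).list.length ≤ (source a).width ^ loopExp d := fun _ _ _ _ => Source.length_le _ _
  refine PP.existsLt (P := fun a z => (source a).entry z = 0 ∧ ∀ q < (source a).list.length, q < z →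
    (∃ y < (source a).list.length, y < z ∧ q ≤ y ∧ (source a).entry y = 0) ∨
      ∃ j < m + 1, (source a).Falsified ((source a).digit (3 * j + 1) (f a))
        ((source a).digit (3 * j + 2) (f a)) q) ?_ PC.length (hN _)
  refine (PP.eq (α := α × ℕ) PC.snd.entry (.const 0)).and (PP.forallLt (α := α × ℕ)
    (P := fun a q => q < a.2 →
    (∃ y < (source a).list.length, y < a.2 ∧ q ≤ y ∧ (source a).entry y = 0) ∨
      ∃ j < m + 1, (source a).Falsified ((source a).digit (3 * j + 1) (f a.1))
        ((source a).digit (3 * j + 2) (f a.1)) q) ?_ PC.length (hN _))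
  refine (PP.lt PC.snd PC.snd.comp_fst).imp (PP.or ?_ ?_)
  · refine PP.existsLt (α := (α × ℕ) × ℕ) (P := fun a y => y < a.1.2 ∧ a.2 ≤ y ∧
      (source a).entry y = 0) ?_ PC.length (hN _)
    exact (PP.lt PC.snd PC.snd.comp_fst.comp_fst).and
      ((PP.le PC.snd.comp_fst PC.snd).and (PP.eq (α := ((α × ℕ) × ℕ) × ℕ) PC.snd.entry (.const 0)))
  · exact PP.existsConst (α := (α × ℕ) × ℕ) _ fun j _ => PP.falsified (α := (α × ℕ) × ℕ)
      (hf.digit hsf _).comp_fst.comp_fst (hf.digit hsf _).comp_fst.comp_fst PC.snd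

theorem PP.node (hf : PC (loopExp d) f) (hsf : Small (loopExp d) f) (m : ℕ) :
    PP (loopExp d) fun a => (source a).Node m (f a) :=
  (PP.malformed m).not.and ((PP.compat hf hf hsf hsf m).and
    ((PP.forallConst _ fun _ _ => PP.slotOk (hf.digit hsf _) (hf.digit hsf _) (hf.digit hsf _)).and
      (PP.refuted hf hsf m).not))

theorem PC.order : PC (loopExp d) fun a : α => (source a).order d :=
  PC.pow PC.width _ fun _ _ => Source.width_le _ _

theorem PP.adj (hf : PC (loopExp d) f) (hg : PC (loopExp d) g) (hsf : Small (loopExp d) f)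
    (hsg : Small (loopExp d) g) : PP (loopExp d) fun a => (source a).Adj d (f a) (g a) :=
  (PP.lt hf PC.order).and ((PP.lt hg PC.order).and ((PP.ne hf hg).and ((PP.node hf hsf d).and
    ((PP.node hg hsg d).and ((PP.compat hf hg hsf hsg d).and (PP.compat hg hf hsg hsf d))))))

theorem PC.orderPow (m : ℕ) : PC (loopExp d) fun a : α => (source a).order d ^ m :=
  PC.pow PC.order _ fun _ _ => Source.order_le _ _

theorem PC.cliqueSize : PC (loopExp d) fun a : α => (source a).cliqueSize d :=
  PC.pow (PC.param.add (.const 2)) _ fun a _ =>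
    le_trans (by unfold Source.width; omega) ((source a).width_le d)

theorem PC.matrix (hf : PC (loopExp d) f) (hg : PC (loopExp d) g) (hsf : Small (loopExp d) f)
    (hsg : Small (loopExp d) g) : PC (loopExp d) fun a => (source a).matrix d (f a) (g a) := by
  classical
  refine PP.cond (PP.eq hf hg) (.const 0) (PP.cond ?_ (.const 1) (.const 2))
  have hn : PC (loopExp d) fun a : α => (source a).order d := PC.order
  have hD := hn.add (PC.orderPow 3)
  exact (PP.adj hf hg hsf hsg).or (((PP.lt hf hn).and ((PP.le hn hg).and ((PP.lt hg hD).and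
    (PP.adj hf (hg.sub hn) hsf fun a ha => (Nat.sub_le _ _).trans (hsg a ha)).not))).or
    (((PP.lt hg hn).and ((PP.le hn hf).and ((PP.lt hf hD).and
    (PP.adj hg (hf.sub hn) hsg fun a ha => (Nat.sub_le _ _).trans (hsf a ha)).not))).or
    ((PP.le hn hf).and (PP.le hn hg))))

theorem PC.output (hf : PC (loopExp d) f) (hsf : Small (loopExp d) f) :
    PC (loopExp d) fun a => (source a).output d (f a) := by
  have hk : PC (loopExp d) fun a : α => (source a).cliqueSize d := PC.cliqueSize
  have hks : Small (loopExp d) fun a : α => (source a).cliqueSize d :=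
    fun a _ => (source a).cliqueSize_le d
  have hN : PC (loopExp d) fun a : α => (source a).vertices d := PC.orderPow 5
  have hNs : Small (loopExp d) fun a : α => (source a).vertices d :=
    fun a _ => (source a).vertices_le d
  have hN0 : ∀ a : α, valid (loopExp d) a → 0 < (source a).vertices d :=
    fun a _ => (source a).vertices_pos d
  have h3 : Small (loopExp d) fun a : α => f a - 3 :=
    fun a ha => (Nat.sub_le _ _).trans (hsf a ha)
  refine PP.cond (PP.eq hf (.const 0)) ((PC.mul hk (PC.orderPow 3) hks).sub
    (PC.mul hk (hk.sub (.const 1)) hks).half) (PP.cond (PP.eq hf (.const 1)) hk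
    (PP.cond (PP.eq hf (.const 2)) hN (PC.matrix (PC.div (hf.sub (.const 3)) hN h3 hN0)
    (PC.mod (hf.sub (.const 3)) hN h3 hNs hN0) ?_ ?_)))
  · exact fun a ha => (Nat.div_le_self _ _).trans (h3 a ha)
  · exact fun a ha => (Nat.mod_le _ _).trans (h3 a ha)

theorem PC.outputLength : PC (loopExp d) fun a : α => (source a).outputLength d :=
  (PC.mul (PC.orderPow 5) (PC.orderPow 5) fun _ _ => Source.order_pow_le _ _ (by simp)).add
    (.const 3)

end construction

/-! ## Connectivity of graphs after the removal of few edges -/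

section graph
variable {V : Type*} {G Y : SimpleGraph V}

/-- In the clique, `x` and `y` are joined by the `X.card - 1` edge-disjoint paths through one
further vertex `w`, or the edge itself for `w = y`. Separating them takes one deleted edge from each
path. -/
theorem reachable_deleteEdges_of_card_lt [DecidableEq V] (I : Finset (Sym2 V)) (X : Finset V)
    (hX : ∀ x ∈ X, ∀ y ∈ X, x ≠ y → G.Adj x y) (hI : I.card + 2 ≤ X.card) {x y : V}
    (hx : x ∈ X) (hy : y ∈ X) : (G.deleteEdges (I : Set (Sym2 V))).Reachable x y := by
  by_contra hxy
  have hne : x ≠ y := fun h => hxy (h ▸ .refl _)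
  have key : ∀ w ∈ X.erase x, s(x, w) ∉ I → w ≠ y ∧ s(w, y) ∈ I := by
    intro w hw hwI
    obtain ⟨hwx, hw⟩ := Finset.mem_erase.1 hw
    have h1 : (G.deleteEdges (I : Set (Sym2 V))).Adj x w := by
      rw [SimpleGraph.deleteEdges_adj]; exact ⟨hX x hx w hw hwx.symm, by simpa using hwI⟩
    have hwy : w ≠ y := fun h => hxy (h ▸ h1.reachable)
    refine ⟨hwy, by_contra fun hI' => hxy (h1.reachable.trans ?_)⟩
    exact SimpleGraph.Adj.reachable (by
      rw [SimpleGraph.deleteEdges_adj]; exact ⟨hX w hw y hy hwy, by simpa using hI'⟩)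
  have : (X.erase x).card ≤ I.card := by
    refine Finset.card_le_card_of_injOn (fun w => if s(x, w) ∈ I then s(x, w) else s(w, y)) ?_ ?_
    · intro w hw
      dsimp only
      split_ifs with h
      · exact h
      · exact (key w hw h).2
    · intro w hw w' hw' h
      dsimp only at h
      have hwx := (Finset.mem_erase.1 hw).1
      have hwx' := (Finset.mem_erase.1 hw').1
      split_ifs at h with h1 h2 h2
      · rcases Sym2.eq_iff.1 h with ⟨_, h⟩ | ⟨_, h⟩
        · exact h
        · exact absurd h hwx
      · rcases Sym2.eq_iff.1 h with ⟨h, _⟩ | ⟨h, _⟩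
        · exact absurd h.symm hwx'
        · exact absurd h hne
      · rcases Sym2.eq_iff.1 h with ⟨h, _⟩ | ⟨_, h⟩
        · exact absurd h hwx
        · exact absurd h.symm hne
      · rcases Sym2.eq_iff.1 h with ⟨h, _⟩ | ⟨h, _⟩
        · exact h
        · exact absurd h (key w hw h1).1
  rw [Finset.card_erase_of_mem hx] at this
  omega

/-- As long as `Y` is disconnected, some edge of `G` joins two of its components; add it and induct
on the number of components. A spanning tree of the final graph uses at most the added edges outside
`Y`. -/
theorem exists_isTree_ncard_diff_le [Finite V] (hG : G.Connected) (hY : Y ≤ G) :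
    ∃ T ≤ G, T.IsTree ∧ (T.edgeSet \ Y.edgeSet).ncard + 1 ≤ Nat.card Y.ConnectedComponent := by
  induction hm : Nat.card Y.ConnectedComponent using Nat.strong_induction_on generalizing Y with
  | _ m ih =>
  have := hG.nonempty
  by_cases hc : Y.Connected
  · obtain ⟨T, hT, hT'⟩ := hc.exists_isTree_le
    refine ⟨T, hT.trans hY, hT', ?_⟩
    rw [Set.sdiff_eq_empty.2 (SimpleGraph.edgeSet_mono hT), Set.ncard_empty, ← hm]
    exact Nat.card_pos
  · obtain ⟨u, v, huv, hnr⟩ : ∃ u v, G.Adj u v ∧ ¬Y.Reachable u v := by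
      by_contra! h
      refine hc ⟨fun u v => ?_⟩
      obtain ⟨p⟩ := hG.preconnected u v
      induction p with
      | nil => exact .refl _
      | cons h' _ ih => exact (h _ _ h').trans ih
    have hle : Y ≤ Y ⊔ SimpleGraph.edge u v := le_sup_left
    have hadj : (Y ⊔ SimpleGraph.edge u v).Adj u v := by
      simp [SimpleGraph.edge_adj, huv.ne]
    -- The map on components is surjective; if their number did not drop it would be bijective, so
    -- `u` and `v` would already be joined in `Y`.
    have hlt : Nat.card (Y ⊔ SimpleGraph.edge u v).ConnectedComponent < m := by
      rw [← hm]
      by_contra! hcard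
      have hb := (SimpleGraph.ConnectedComponent.surjective_map_ofLE hle).bijective_of_nat_card_le
        hcard
      refine hnr (SimpleGraph.ConnectedComponent.exact (hb.1 ?_))
      exact SimpleGraph.ConnectedComponent.sound hadj.reachable
    obtain ⟨T, hT, hT', hn⟩ := ih _ hlt (sup_le hY (by
      intro a b hab
      rw [SimpleGraph.edge_adj] at hab
      rcases hab.1 with ⟨rfl, rfl⟩ | ⟨rfl, rfl⟩
      · exact huv
      · exact huv.symm)) rfl
    refine ⟨T, hT, hT', ?_⟩
    have hsub : T.edgeSet \ Y.edgeSet ⊆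
        insert s(u, v) (T.edgeSet \ (Y ⊔ SimpleGraph.edge u v).edgeSet) := by
      intro e he
      by_cases h : e = s(u, v)
      · exact .inl h
      · refine .inr ⟨he.1, fun h' => he.2 ?_⟩
        rw [SimpleGraph.edgeSet_sup] at h'
        rcases h' with h' | h'
        · exact h'
        · rw [SimpleGraph.edge, SimpleGraph.edgeSet_fromEdgeSet] at h'
          exact absurd h'.1 h
    have h1 := Set.ncard_le_ncard hsub (Set.toFinite _)
    have h2 := Set.ncard_insert_le s(u, v) (T.edgeSet \ (Y ⊔ SimpleGraph.edge u v).edgeSet)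
    omega

/-- Contracting the fibers of `f` leaves a connected graph on `α`, which has at least `Nat.card α -
1` edges, each the image of an edge between different fibers. -/
theorem card_le_ncard_add_one_of_surjective [Finite V] {α : Type*} (hG : G.Connected) {f : V → α}
    (hf : Function.Surjective f) :
    Nat.card α ≤ {e ∈ G.edgeSet | ¬(e.map f).IsDiag}.ncard + 1 := by
  let Q : SimpleGraph α := .fromEdgeSet (Sym2.map f '' G.edgeSet)
  have hr : ∀ x y, G.Adj x y → Q.Reachable (f x) (f y) := fun x y hxy => by
    by_cases h : f x = f y
    · rw [h]
    · exact SimpleGraph.Adj.reachable ((SimpleGraph.fromEdgeSet_adj _).2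
        ⟨⟨s(x, y), hxy, rfl⟩, h⟩)
  have hQ : Q.Connected := by
    have := hG.nonempty.map f
    refine ⟨fun a b => ?_⟩
    obtain ⟨x, rfl⟩ := hf a
    obtain ⟨y, rfl⟩ := hf b
    obtain ⟨p⟩ := hG.preconnected x y
    induction p with
    | nil => exact .refl _
    | cons h' _ ih => exact (hr _ _ h').trans ih
  refine hQ.card_vert_le_card_edgeSet_add_one.trans (Nat.add_le_add_right ?_ 1)
  rw [Nat.card_coe_set_eq]
  refine (Set.ncard_le_ncard (t := Sym2.map f '' {e ∈ G.edgeSet | ¬(e.map f).IsDiag}) ?_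
    (Set.toFinite _)).trans (Set.ncard_image_le (Set.toFinite _))
  intro e he
  rw [SimpleGraph.edgeSet_fromEdgeSet] at he
  obtain ⟨⟨e, h1, rfl⟩, h2⟩ := he
  exact ⟨e, ⟨h1, h2⟩, rfl⟩

end graph

theorem card_filter_snd_lt_fst (U : Finset ℕ) :
    ((U ×ˢ U).filter fun p => p.2 < p.1).card = U.card * (U.card - 1) / 2 := by
  have h1 : U.offDiag = ((U ×ˢ U).filter fun p => p.2 < p.1) ∪
      ((U ×ˢ U).filter fun p => p.1 < p.2) := by
    ext ⟨a, b⟩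
    simp only [Finset.mem_offDiag, Finset.mem_union, Finset.mem_filter, Finset.mem_product]
    constructor
    · rintro ⟨ha, hb, h⟩
      rcases lt_or_gt_of_ne h with h | h <;> simp [ha, hb, h]
    · rintro (⟨⟨ha, hb⟩, h⟩ | ⟨⟨ha, hb⟩, h⟩)
      · exact ⟨ha, hb, h.ne'⟩
      · exact ⟨ha, hb, h.ne⟩
  have h2 : ((U ×ˢ U).filter fun p => p.1 < p.2).card =
      ((U ×ˢ U).filter fun p => p.2 < p.1).card := by
    refine Finset.card_bij' (fun p _ => p.swap) (fun p _ => p.swap) ?_ ?_ ?_ ?_ <;>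
      simp +contextual
  have h3 := U.offDiag_card
  rw [h1, Finset.card_union_of_disjoint (Finset.disjoint_filter.2 fun p _ h h' => by omega), h2]
    at h3
  rw [Nat.mul_sub, mul_one]
  omega

/-! ## Cliques and most vital edges -/

/-- The graph of the edges of weight zero. -/
def zeroGraph (n D N : ℕ) (adj : ℕ → ℕ → Prop) (hs : ∀ u v, adj u v → adj v u) :
    SimpleGraph (Fin N) where
  Adj u v := u ≠ v ∧ ZeroEdge n D adj u v
  symm := ⟨fun u v h => ⟨h.1.symm, by
    obtain ⟨_, h | h | h | h⟩ := h
    · exact .inl (hs _ _ h)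
    · exact .inr (.inr (.inl h))
    · exact .inr (.inl h)
    · exact .inr (.inr (.inr h.symm))⟩⟩
  loopless := ⟨fun _ h => h.1 rfl⟩

theorem zeroGraph_adj {n D N : ℕ} {adj : ℕ → ℕ → Prop} {hs : ∀ u v, adj u v → adj v u}
    {u v : Fin N} : (zeroGraph n D N adj hs).Adj u v ↔ u ≠ v ∧ ZeroEdge n D adj u v :=
  Iff.rfl

theorem totalWeight_ind {V : Type*} [Fintype V] (H T : SimpleGraph V) :
    totalWeight (fun e => ind (e ∉ H.edgeSet)) T = (T.edgeSet \ H.edgeSet).ncard := by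
  classical
  have h : ∀ e : Sym2 V, ind (e ∉ H.edgeSet) = if e ∉ H.edgeSet then 1 else 0 := fun e => by
    unfold ind; congr
  unfold totalWeight
  simp only [h]
  rw [← Finset.sum_filter, Finset.sum_const, smul_eq_mul, mul_one, ← Set.ncard_coe_finset]
  congr 1
  ext e
  simp

section deletion
variable {n D N k : ℕ} {adj : ℕ → ℕ → Prop}

/-- The neighbors of `u` along edges of weight zero, numbered from `0` to `D - 1`. -/
noncomputable def neighbor (n : ℕ) (adj : ℕ → ℕ → Prop) (u j : ℕ) : ℕ := by
  classical exact if adj u j then j else n + j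

theorem zeroEdge_neighbor {u j : ℕ} (hu : u < n) (hj : j < D) :
    ZeroEdge n D adj u (neighbor n adj u j) := by
  unfold neighbor
  by_cases h : adj u j
  · rw [if_pos h]; exact .inl h
  · rw [if_neg h]; exact .inr (.inl ⟨hu, by omega, by omega, by simpa using h⟩)

/-- Once all zero edges meeting `U` are gone, a spanning tree must connect the `k` vertices of `U`
and the contracted rest by edges of weight one. -/
theorem exists_deletion_of_clique (hs : ∀ u v, adj u v → adj v u)
    (hlt : ∀ u v, adj u v → u < n ∧ v < n) (hnD : n ≤ D) (hN : n < N)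
    {U : Finset ℕ} (hU : U.card = k) (hUn : ∀ u ∈ U, u < n)
    (hcl : ∀ u ∈ U, ∀ v ∈ U, u ≠ v → adj u v) :
    ∃ I : Finset (Sym2 (Fin N)), (I : Set (Sym2 (Fin N))) ⊆ (⊤ : SimpleGraph (Fin N)).edgeSet ∧
      I.card ≤ budget D k ∧ (k : ℕ∞) ≤ mstWeight
        ((⊤ : SimpleGraph (Fin N)).deleteEdges (I : Set (Sym2 (Fin N))))
        fun e => ind (e ∉ (zeroGraph n D N adj hs).edgeSet) := by
  classical
  set H := zeroGraph n D N adj hs with hH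
  let I : Finset (Sym2 (Fin N)) := H.edgeFinset.filter fun e => ∃ x : Fin N, (x : ℕ) ∈ U ∧ x ∈ e
  refine ⟨I, fun e he => ?_, ?_, ?_⟩
  · have : e ∈ H.edgeSet := by
      have := (Finset.mem_filter.1 he).1
      simpa using this
    exact SimpleGraph.edgeSet_mono le_top this
  -- A pair `(u, j)` stands for the zero edge from `u` to its neighbor number `j`. An edge inside
  -- the clique would be listed from both ends; only the listing from the smaller end is kept, which
  -- leaves exactly `budget D k` pairs.
  · let P := (U ×ˢ Finset.range D).filter fun p => ¬(p.2 ∈ U ∧ p.2 < p.1)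
    have hP : P.card = budget D k := by
      have h1 := Finset.card_filter_add_card_filter_not (s := U ×ˢ Finset.range D)
        fun p => p.2 ∈ U ∧ p.2 < p.1
      have h2 : (U ×ˢ Finset.range D).filter (fun p => p.2 ∈ U ∧ p.2 < p.1) =
          (U ×ˢ U).filter fun p => p.2 < p.1 := by
        ext ⟨a, b⟩
        simp only [Finset.mem_filter, Finset.mem_product, Finset.mem_range]
        constructor
        · rintro ⟨⟨h1, _⟩, h2, h3⟩; exact ⟨⟨h1, h2⟩, h3⟩
        · rintro ⟨⟨h1, h2⟩, h3⟩; exact ⟨⟨h1, (hUn _ h2).trans_le hnD⟩, h2, h3⟩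
      rw [h2, card_filter_snd_lt_fst, Finset.card_product, Finset.card_range, hU] at h1
      change _ + P.card = _ at h1
      unfold budget
      omega
    have hsub : I.image (Sym2.map Fin.val) ⊆ P.image fun p => s(p.1, neighbor n adj p.1 p.2) := by
      intro e he
      obtain ⟨e, heI, rfl⟩ := Finset.mem_image.1 he
      obtain ⟨heH, x, hxU, hxe⟩ := Finset.mem_filter.1 heI
      obtain ⟨y, rfl⟩ := hxe
      have hxy : H.Adj x y := by simpa using heH
      have hxn := hUn _ hxU
      rw [Finset.mem_image]
      rcases (zeroGraph_adj.1 hxy).2 with h | ⟨_, h1, h2, h3⟩ | ⟨_, h1, _⟩ | ⟨h1, _⟩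
      · by_cases hy : (y : ℕ) ∈ U ∧ (y : ℕ) < x
        · refine ⟨(y, x), Finset.mem_filter.2 ⟨Finset.mem_product.2 ⟨hy.1, ?_⟩, ?_⟩, ?_⟩
          · exact Finset.mem_range.2 (hxn.trans_le hnD)
          · rintro ⟨_, h⟩; simp only at h; omega
          · simp [neighbor, hs _ _ h, Sym2.eq_swap]
        · refine ⟨(x, y), Finset.mem_filter.2 ⟨Finset.mem_product.2 ⟨hxU, ?_⟩, hy⟩, ?_⟩
          · exact Finset.mem_range.2 ((hlt _ _ h).2.trans_le hnD)
          · simp [neighbor, h]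
      · refine ⟨(x, y - n), Finset.mem_filter.2 ⟨Finset.mem_product.2 ⟨hxU, ?_⟩, ?_⟩, ?_⟩
        · exact Finset.mem_range.2 (by omega)
        · rintro ⟨h4, h5⟩
          exact h3 (hcl _ hxU _ h4 (ne_of_gt h5))
        · simp [neighbor, h3, Nat.add_sub_cancel' h1]
      · omega
      · omega
    rw [← hP, ← Finset.card_image_of_injective I (Sym2.map.injective Fin.val_injective)]
    exact (Finset.card_le_card hsub).trans Finset.card_image_le
  · refine le_iInf₂ fun T hT => ?_
    rw [totalWeight_ind]
    -- Everything outside `U` is contracted to `none`; the vertex `n` shows that this fiber is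
    -- nonempty.
    let f : Fin N → Option U := fun x => if h : (x : ℕ) ∈ U then some ⟨x, h⟩ else none
    have hf : Function.Surjective f := by
      rintro (_ | ⟨u, hu⟩)
      · exact ⟨⟨n, hN⟩, dif_neg fun h => (hUn _ h).false⟩
      · exact ⟨⟨u, (hUn u hu).trans hN⟩, dif_pos hu⟩
    have h := card_le_ncard_add_one_of_surjective hT.2.connected hf
    have hc : Nat.card (Option U) = k + 1 := by
      rw [Nat.card_eq_fintype_card, Fintype.card_option, Fintype.card_coe, hU]
    rw [hc] at h
    have hsub : {e ∈ T.edgeSet | ¬(e.map f).IsDiag} ⊆ T.edgeSet \ H.edgeSet := by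
      rintro e ⟨he, hd⟩
      refine ⟨he, fun heH => ?_⟩
      induction e with | _ x y =>
      have hxy : f x ≠ f y := by simpa using hd
      have hI : s(x, y) ∉ I := by
        have := hT.1 he
        rw [SimpleGraph.deleteEdges_adj] at this
        simpa using this.2
      refine hI (Finset.mem_filter.2 ⟨by simpa using heH, ?_⟩)
      by_contra! hno
      have h1 : f x = none := dif_neg fun h => hno x h (by simp)
      have h2 : f y = none := dif_neg fun h => hno y h (by simp)
      exact hxy (h1.trans h2.symm)
    have := Set.ncard_le_ncard hsub (Set.toFinite _)
    exact_mod_cast (by omega : k ≤ (T.edgeSet \ H.edgeSet).ncard)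

/-- The hypotheses `hb` and `hpad` say that the budget can neither disconnect the clique of the
vertices from `n` on nor remove the padding edges with index at least `n` at `k + 1` vertices. With
at least `k + 1` components forced by the weight, the cut-off vertices are exactly `k` singletons,
and counting their zero edges leaves no room for a nonadjacent pair. -/
theorem clique_of_deletion (hs : ∀ u v, adj u v → adj v u)
    (hlt : ∀ u v, adj u v → u < n ∧ v < n) (hirr : ∀ u, ¬adj u u) (hnD : n ≤ D) (hN : n + D ≤ N)
    (hb : budget D k + n + 2 ≤ N) (hpad : budget D k < (k + 1) * (D - n))
    {I : Finset (Sym2 (Fin N))} (hI : I.card ≤ budget D k)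
    (hw : (k : ℕ∞) ≤ mstWeight ((⊤ : SimpleGraph (Fin N)).deleteEdges (I : Set (Sym2 (Fin N))))
        fun e => ind (e ∉ (zeroGraph n D N adj hs).edgeSet)) :
    ∃ U : Finset ℕ, U.card = k ∧ (∀ u ∈ U, u < n) ∧ ∀ u ∈ U, ∀ v ∈ U, u ≠ v → adj u v := by
  classical
  set H := zeroGraph n D N adj hs with hH
  set Y := H.deleteEdges (I : Set (Sym2 (Fin N))) with hYdef
  have hn : n < N := by omega
  have : Nonempty (Fin N) := ⟨⟨n, hn⟩⟩
  have hconn : ((⊤ : SimpleGraph (Fin N)).deleteEdges (I : Set (Sym2 (Fin N)))).Connected :=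
    ⟨fun x y => reachable_deleteEdges_of_card_lt I Finset.univ (fun _ _ _ _ h => h)
      (by rw [Finset.card_univ, Fintype.card_fin]; omega) (Finset.mem_univ _) (Finset.mem_univ _)⟩
  obtain ⟨T, hT, hT', hTn⟩ := exists_isTree_ncard_diff_le (Y := Y) hconn
    (SimpleGraph.deleteEdges_mono le_top)
  -- The tree avoids `I`, so its edges of weight one are precisely those outside `Y`.
  have hTI : T.edgeSet \ H.edgeSet = T.edgeSet \ Y.edgeSet := by
    ext e
    refine and_congr_right fun he => not_congr ?_
    have := SimpleGraph.edgeSet_mono hT he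
    rw [SimpleGraph.edgeSet_deleteEdges] at this
    rw [hYdef, SimpleGraph.edgeSet_deleteEdges]
    exact ⟨fun h => ⟨h, this.2⟩, fun h => h.1⟩
  have hk : k + 1 ≤ Nat.card Y.ConnectedComponent := by
    have h1 : (k : ℕ∞) ≤ _ := hw.trans (iInf₂_le T ⟨hT, hT'⟩)
    rw [totalWeight_ind, hTI] at h1
    have h2 : k ≤ (T.edgeSet \ Y.edgeSet).ncard := by exact_mod_cast h1
    omega
  let comp : Fin N → Y.ConnectedComponent := Y.connectedComponentMk
  let c₀ := comp ⟨n, hn⟩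
  have hbig : ∀ x : Fin N, n ≤ x → comp x = c₀ := by
    intro x hx
    refine SimpleGraph.ConnectedComponent.sound (reachable_deleteEdges_of_card_lt I
      (Finset.univ.filter fun x : Fin N => n ≤ x) ?_ ?_ (by simpa using hx) (by simp))
    · intro a ha b hb hab
      exact zeroGraph_adj.2 ⟨hab, .inr (.inr (.inr ⟨by simpa using ha, by simpa using hb⟩))⟩
    · have : (Finset.univ.filter fun x : Fin N => n ≤ x) = Finset.Ici ⟨n, hn⟩ := by
        ext x; simp [Fin.le_def]
      rw [this, Fin.card_Ici]
      simp only
      omega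
  let W : Finset (Fin N) := Finset.univ.filter fun x => comp x ≠ c₀
  have hWn : ∀ x ∈ W, (x : ℕ) < n := fun x hx => by
    by_contra h
    exact (Finset.mem_filter.1 hx).2 (hbig x (by omega))
  have hmemI : ∀ x y : Fin N, H.Adj x y → comp x ≠ comp y → s(x, y) ∈ I := by
    intro x y hxy hne
    by_contra h
    refine hne (SimpleGraph.ConnectedComponent.sound (SimpleGraph.Adj.reachable ?_))
    rw [hYdef, SimpleGraph.deleteEdges_adj]
    exact ⟨hxy, by simpa using h⟩
  have hWk : W.card ≤ k := by
    by_contra! hlt'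
    -- For `n ≤ j < D` the vertex `n + j` is always a padding neighbor, because `adj` lives below
    -- `n`. It lies in the component `c₀`, so the edge to it must have been deleted.
    have : (W ×ˢ Finset.Ico n D).card ≤ (I.image (Sym2.map Fin.val)).card := by
      refine Finset.card_le_card_of_injOn (fun p => s((p.1 : ℕ), n + p.2)) ?_ ?_
      · rintro ⟨u, j⟩ hp
        obtain ⟨hu, hj⟩ := Finset.mem_product.1 (Finset.mem_coe.1 hp)
        obtain ⟨hj1, hj2⟩ := Finset.mem_Ico.1 hj
        simp only at hu hj1 hj2
        have hun := hWn u hu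
        refine Finset.mem_image.2 ⟨s(u, ⟨n + j, by omega⟩),
          hmemI _ _ (zeroGraph_adj.2 ⟨?_, ?_⟩) ?_, rfl⟩
        · intro h
          have := congrArg Fin.val h
          simp only at this; omega
        · refine .inr (.inl ⟨hun, by simp, by simpa using hj2, fun h => ?_⟩)
          have := (hlt _ _ h).2
          simp only at this; omega
        · rw [hbig ⟨n + j, _⟩ (by simp)]
          exact (Finset.mem_filter.1 hu).2
      · rintro ⟨u, j⟩ hp ⟨u', j'⟩ hp' h
        have hu := hWn _ (Finset.mem_product.1 (Finset.mem_coe.1 hp)).1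
        have hu' := hWn _ (Finset.mem_product.1 (Finset.mem_coe.1 hp')).1
        simp only at hu hu' h
        rcases Sym2.eq_iff.1 h with ⟨h1, h2⟩ | ⟨h1, h2⟩
        · exact Prod.ext (Fin.ext h1) (by simp only; omega)
        · omega
    rw [Finset.card_product, Nat.card_Ico] at this
    have h1 := this.trans (Finset.card_image_le.trans hI)
    have h2 := Nat.mul_le_mul_right (D - n) hlt'
    simp only [Nat.succ_eq_add_one] at h2
    omega
  -- Every component other than `c₀` meets `W`. Together with `hWk` this makes `comp` injective on
  -- `W`, so each vertex of `W` is a component of its own and has lost all its zero edges.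
  have himage : k ≤ (W.image comp).card := by
    have : Fintype Y.ConnectedComponent := Fintype.ofFinite _
    have h1 : (Finset.univ.erase c₀ : Finset Y.ConnectedComponent) ⊆ W.image comp := by
      intro c hc
      induction c using SimpleGraph.ConnectedComponent.ind with | _ x =>
      exact Finset.mem_image.2 ⟨x, Finset.mem_filter.2
        ⟨Finset.mem_univ _, (Finset.mem_erase.1 hc).1⟩, rfl⟩
    have h2 := Finset.card_le_card h1
    rw [Finset.card_erase_of_mem (Finset.mem_univ _), Finset.card_univ,
      ← Nat.card_eq_fintype_card] at h2
    omega
  have hWcard : W.card = k := le_antisymm hWk (himage.trans Finset.card_image_le)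
  have hinj : Set.InjOn comp W :=
    Finset.injOn_of_card_image_eq (le_antisymm Finset.card_image_le (by omega))
  have hall : ∀ x ∈ W, ∀ y, H.Adj x y → s(x, y) ∈ I := by
    intro x hx y hxy
    refine hmemI x y hxy fun h => ?_
    refine hxy.ne (hinj hx ?_ h)
    have := (Finset.mem_filter.1 hx).2
    exact Finset.mem_filter.2 ⟨Finset.mem_univ _, h ▸ this⟩
  have hUcard : (W.image Fin.val).card = k := by
    rw [Finset.card_image_of_injective _ Fin.val_injective, hWcard]
  set U := W.image Fin.val with hU
  have hUn : ∀ u ∈ U, u < n := fun u hu => by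
    obtain ⟨x, hx, rfl⟩ := Finset.mem_image.1 hu
    exact hWn x hx
  refine ⟨U, hUcard, hUn, ?_⟩
  by_contra! hno
  obtain ⟨u₀, hu₀, v₀, hv₀, hne₀, hnadj⟩ := hno
  -- These are the double listings of zero edges inside `U`. A missing adjacency makes them fewer
  -- than `k * (k - 1) / 2`, so more than `budget D k` edges would have been deleted.
  let X := (U ×ˢ Finset.range D).filter fun p => adj p.1 p.2 ∧ p.2 ∈ U ∧ p.2 < p.1
  let P := (U ×ˢ Finset.range D).filter fun p => ¬(adj p.1 p.2 ∧ p.2 ∈ U ∧ p.2 < p.1)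
  have hXP : X.card + P.card = k * D := by
    rw [Finset.card_filter_add_card_filter_not, Finset.card_product, Finset.card_range, hUcard]
  have hX : X.card < k * (k - 1) / 2 := by
    rw [← hUcard, ← card_filter_snd_lt_fst]
    refine Finset.card_lt_card ((Finset.ssubset_iff_of_subset ?_).2 ?_)
    · rintro ⟨a, b⟩ h
      obtain ⟨h1, _, h2, h3⟩ := Finset.mem_filter.1 h
      exact Finset.mem_filter.2 ⟨Finset.mem_product.2 ⟨(Finset.mem_product.1 h1).1, h2⟩, h3⟩
    · rcases lt_or_gt_of_ne hne₀ with h | h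
      · refine ⟨(v₀, u₀), Finset.mem_filter.2 ⟨Finset.mem_product.2 ⟨hv₀, hu₀⟩, h⟩, fun h' => ?_⟩
        exact hnadj (hs _ _ (Finset.mem_filter.1 h').2.1)
      · refine ⟨(u₀, v₀), Finset.mem_filter.2 ⟨Finset.mem_product.2 ⟨hu₀, hv₀⟩, h⟩, fun h' => ?_⟩
        exact hnadj (Finset.mem_filter.1 h').2.1
  have hP : P.card ≤ (I.image (Sym2.map Fin.val)).card := by
    refine Finset.card_le_card_of_injOn (fun p => s(p.1, neighbor n adj p.1 p.2)) ?_ ?_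
    · rintro ⟨u, j⟩ hp
      obtain ⟨hu, hj⟩ := Finset.mem_product.1 (Finset.mem_filter.1 (Finset.mem_coe.1 hp)).1
      obtain ⟨x, hx, rfl⟩ := Finset.mem_image.1 hu
      have hj : j < D := Finset.mem_range.1 hj
      have hxn := hWn x hx
      have hlt' : neighbor n adj x j < N := by
        unfold neighbor; split_ifs <;> omega
      refine Finset.mem_image.2 ⟨s(x, ⟨neighbor n adj x j, hlt'⟩),
        hall x hx _ (zeroGraph_adj.2 ⟨?_, ?_⟩), rfl⟩
      · intro h
        have h' := congrArg Fin.val h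
        simp only [neighbor] at h'
        split_ifs at h' with h1
        · rw [← h'] at h1; exact hirr _ h1
        · omega
      · exact zeroEdge_neighbor hxn hj
    · rintro ⟨u, j⟩ hp ⟨u', j'⟩ hp' h
      obtain ⟨h1, h2⟩ := Finset.mem_filter.1 (Finset.mem_coe.1 hp)
      obtain ⟨h1', h2'⟩ := Finset.mem_filter.1 (Finset.mem_coe.1 hp')
      have hu := (Finset.mem_product.1 h1).1
      have hu' := (Finset.mem_product.1 h1').1
      simp only at hu hu' h h2 h2'
      have hun := hUn _ hu
      have hun' := hUn _ hu'
      rcases Sym2.eq_iff.1 h with ⟨rfl, h4⟩ | ⟨h3, h4⟩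
      · refine Prod.ext rfl ?_
        simp only [neighbor] at h4 ⊢
        split_ifs at h4 with h5 h6 h6
        · exact h4
        · have := (hlt _ _ h5).2; omega
        · have := (hlt _ _ h6).2; omega
        · omega
      · simp only [neighbor] at h3 h4
        split_ifs at h3 h4 with h5 h6 h6
        · subst h3 h4
          have h7 : ¬j < u := fun h => h2 ⟨h6, hu', h⟩
          have h8 : ¬u < j := fun h => h2' ⟨h5, hu, h⟩
          have : u = j := by omega
          subst this
          exact absurd h5 (hirr _)
        all_goals omega
  have h1 := hP.trans (Finset.card_image_le.trans hI)
  unfold budget at h1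
  have hkD : k ≤ D := by
    have : U ⊆ Finset.range D := fun u hu => Finset.mem_range.2 ((hUn u hu).trans_le hnD)
    simpa [hUcard] using Finset.card_le_card this
  -- This keeps the subtraction in `budget` from being truncated.
  have h2 : k * (k - 1) ≤ k * D := Nat.mul_le_mul_left _ (by omega)
  omega

end deletion

/-! ## Codes of formulas -/

theorem Literal.code_pos (l : Literal) : l.code ≠ 0 := by
  unfold Literal.code; split_ifs <;> omega

theorem Literal.code_var (l : Literal) : (l.code - 1) / 2 = l.1 := by
  unfold Literal.code; split_ifs <;> omega

theorem Literal.code_mod_two (l : Literal) : l.code % 2 = if l.2 = true then 1 else 0 := by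
  unfold Literal.code; split_ifs <;> omega

theorem Literal.exists_code_eq {m : ℕ} (hm : m ≠ 0) : ∃ l : Literal, l.code = m := by
  refine ⟨((m - 1) / 2, decide (m % 2 = 1)), ?_⟩
  unfold Literal.code
  simp only [decide_eq_true_eq]
  split_ifs <;> omega

theorem CNF.encode_append (φ₁ φ₂ : CNF) : (φ₁ ++ φ₂ : CNF).encode = φ₁.encode ++ φ₂.encode := by
  simp [CNF.encode]

theorem CNF.encode_cons (C : List Literal) (φ : CNF) :
    CNF.encode (C :: φ) = C.map Literal.code ++ 0 :: φ.encode := by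
  simp [CNF.encode]

theorem CNF.exists_eq_append {φ : CNF} {C : List Literal} (hC : C ∈ φ) :
    ∃ φ₁ φ₂ : CNF, φ = φ₁ ++ C :: φ₂ :=
  List.append_of_mem hC

theorem CNF.eq_nil_or_eq_append (φ : CNF) :
    φ = [] ∨ ∃ (φ₁ : CNF) (C : List Literal), φ = φ₁ ++ [C] := by
  simpa using List.eq_nil_or_concat φ

theorem CNF.exists_clause_of_lt (φ : CNF) {q : ℕ} (hq : q < φ.encode.length) :
    ∃ (φ₁ : CNF) (C : List Literal) (φ₂ : CNF), φ = φ₁ ++ C :: φ₂ ∧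
      φ₁.encode.length ≤ q ∧ q ≤ φ₁.encode.length + C.length := by
  induction φ generalizing q with
  | nil => simp [CNF.encode] at hq
  | cons C φ ih =>
    rw [CNF.encode_cons] at hq
    simp only [List.length_append, List.length_map, List.length_cons] at hq
    by_cases h : q ≤ C.length
    · exact ⟨[], C, φ, rfl, by simp [CNF.encode], by simpa [CNF.encode] using h⟩
    · obtain ⟨φ₁, C', φ₂, rfl, h1, h2⟩ := ih (q := q - (C.length + 1)) (by omega)
      refine ⟨C :: φ₁, C', φ₂, rfl, ?_, ?_⟩ <;> rw [CNF.encode_cons] <;>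
        simp only [List.length_append, List.length_map, List.length_cons] <;> omega

/-- Cutting at zeros splits any list into complete clauses and an unfinished one. Hence only an
unfinished end or too long a clause can make an input malformed. -/
theorem exists_eq_encode_append (y : List ℕ) :
    ∃ (φ : CNF) (C : List Literal), y = φ.encode ++ C.map Literal.code := by
  induction y with
  | nil => exact ⟨[], [], rfl⟩
  | cons m y ih =>
    obtain ⟨φ, C, rfl⟩ := ih
    by_cases hm : m = 0
    · exact ⟨[] :: φ, C, by rw [CNF.encode_cons]; simp [hm]⟩
    · obtain ⟨l, rfl⟩ := Literal.exists_code_eq hm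
      cases φ with
      | nil => exact ⟨[], l :: C, by simp [CNF.encode]⟩
      | cons C' φ => exact ⟨(l :: C') :: φ, C, by simp [CNF.encode_cons]⟩

namespace Source
variable {i : Source} {d : ℕ}

section decomposition
variable {φ φ₁ φ₂ : CNF} {C : List Literal}

theorem encode_eq (h : i.list = φ.encode) (hφ : φ = φ₁ ++ C :: φ₂) :
    i.list = φ₁.encode ++ (C.map Literal.code ++ 0 :: φ₂.encode) := by
  rw [h, hφ, CNF.encode_append, CNF.encode_cons]

theorem entry_literal (h : i.list = φ.encode) (hφ : φ = φ₁ ++ C :: φ₂) {j : ℕ}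
    (hj : j < C.length) : i.entry (φ₁.encode.length + j) = C[j].code := by
  unfold entry
  rw [encode_eq h hφ, List.getD_append_right _ _ _ _ (by omega), Nat.add_sub_cancel_left,
    List.getD_append _ _ _ _ (by simpa using hj), List.getD_eq_getElem _ _ (by simpa using hj),
    List.getElem_map]

theorem entry_end (h : i.list = φ.encode) (hφ : φ = φ₁ ++ C :: φ₂) :
    i.entry (φ₁.encode.length + C.length) = 0 := by
  unfold entry
  rw [encode_eq h hφ, List.getD_append_right _ _ _ _ (by omega), Nat.add_sub_cancel_left,
    List.getD_append_right _ _ _ _ (by simp)]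
  simp

theorem end_lt (h : i.list = φ.encode) (hφ : φ = φ₁ ++ C :: φ₂) :
    φ₁.encode.length + C.length < i.list.length := by
  rw [encode_eq h hφ]; simp

theorem entry_before (h : i.list = φ.encode) (hφ : φ = φ₁ ++ C :: φ₂)
    (h1 : 0 < φ₁.encode.length) : i.entry (φ₁.encode.length - 1) = 0 := by
  rcases φ₁.eq_nil_or_eq_append with rfl | ⟨φ₀, C₀, rfl⟩
  · simp [CNF.encode] at h1
  · have h2 : φ = φ₀ ++ C₀ :: (C :: φ₂) := by simp [hφ]
    have h3 : (CNF.encode (φ₀ ++ [C₀])).length = φ₀.encode.length + C₀.length + 1 := by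
      rw [CNF.encode_append, CNF.encode_cons]; simp [CNF.encode]; omega
    rw [h3, Nat.add_sub_cancel]
    exact entry_end h h2

end decomposition

theorem entry_of_le {q : ℕ} (h : i.list.length ≤ q) : i.entry q = 0 :=
  List.getD_eq_default _ _ h

theorem lt_of_entry_ne {q : ℕ} (h : i.entry q ≠ 0) : q < i.list.length := by
  by_contra! hq; exact h (entry_of_le hq)

theorem not_malformed_iff : ¬i.Malformed d ↔
    ∃ φ : CNF, i.list = φ.encode ∧ ∀ C ∈ φ, C.length ≤ d := by
  constructor
  · intro h
    simp only [Malformed, not_or, not_and, not_exists, not_not] at h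
    obtain ⟨h1, h2⟩ := h
    obtain ⟨φ, C, hφ⟩ := exists_eq_encode_append i.list
    have hC : C = [] := by
      by_contra hC
      have hpos : 0 < C.length := List.length_pos_iff.2 hC
      have hlen : i.list.length = φ.encode.length + C.length := by rw [hφ]; simp
      have := h1 (by omega)
      unfold entry at this
      rw [hlen, hφ, List.getD_append_right _ _ _ _ (by omega),
        List.getD_eq_getElem _ _ (by simp; omega), List.getElem_map] at this
      exact Literal.code_pos _ this
    subst hC
    simp only [List.map_nil, List.append_nil] at hφ
    refine ⟨φ, hφ, fun C hC => ?_⟩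
    obtain ⟨φ₁, φ₂, hd⟩ := CNF.exists_eq_append hC
    by_contra! hlt
    have hend := end_lt hφ hd
    refine h2 φ₁.encode.length (by omega) fun j hj => ?_
    rw [entry_literal hφ hd (by omega)]
    exact Literal.code_pos _
  · rintro ⟨φ, hφ, hC⟩ (⟨h1, h2⟩ | ⟨q, hq, h⟩)
    · rcases φ.eq_nil_or_eq_append with rfl | ⟨φ₀, C₀, hd⟩
      · simp [hφ, CNF.encode] at h1
      · apply h2
        have : i.list.length - 1 = φ₀.encode.length + C₀.length := by
          rw [encode_eq hφ hd]; simp [CNF.encode]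
        rw [this]
        exact entry_end hφ hd
    · rw [hφ] at hq
      obtain ⟨φ₁, C, φ₂, hd, hq1, hq2⟩ := φ.exists_clause_of_lt hq
      have := hC C (by simp [hd])
      refine h (φ₁.encode.length + C.length - q) (by omega) ?_
      rw [Nat.add_sub_cancel' hq2]
      exact entry_end hφ hd

theorem exists_first {q : ℕ} (hq : i.entry q ≠ 0) : ∃ p, i.First p ∧ i.SameVar p q := by
  classical
  have h : ∃ p, i.SameVar p q := ⟨q, hq, hq, rfl⟩
  have h' := Nat.find_spec h
  refine ⟨Nat.find h, ⟨h'.1, fun p _ hp hs => Nat.find_min h hp ?_⟩, h'⟩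
  exact ⟨hs.1, h'.2.1, hs.2.2.trans h'.2.2⟩

/-- The variable of the literal at position `p`. -/
def variableAt (i : Source) (p : ℕ) : ℕ := (i.entry p - 1) / 2

theorem First.eq_of_variableAt_eq {p q : ℕ} (hp : i.First p) (hq : i.First q)
    (h : i.variableAt p = i.variableAt q) : p = q := by
  rcases lt_trichotomy p q with hlt | h' | hlt
  · exact absurd ⟨hp.1, hq.1, h⟩ (hq.2 p (lt_of_entry_ne hp.1) hlt)
  · exact h'
  · exact absurd ⟨hq.1, hp.1, h.symm⟩ (hp.2 q (lt_of_entry_ne hq.1) hlt)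

theorem mem_vars_iff {φ : CNF} (hφ : i.list = φ.encode) {x : ℕ} :
    x ∈ φ.vars ↔ ∃ p, i.entry p ≠ 0 ∧ i.variableAt p = x := by
  simp only [CNF.vars, List.mem_toFinset, List.mem_map, List.mem_flatten]
  constructor
  · rintro ⟨l, ⟨C, hC, hl⟩, rfl⟩
    obtain ⟨φ₁, φ₂, hd⟩ := CNF.exists_eq_append hC
    obtain ⟨j, hj, rfl⟩ := List.getElem_of_mem hl
    refine ⟨φ₁.encode.length + j, ?_, ?_⟩
    · rw [entry_literal hφ hd hj]; exact Literal.code_pos _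
    · unfold variableAt; rw [entry_literal hφ hd hj]; exact Literal.code_var _
  · rintro ⟨p, hp, rfl⟩
    have hp' := lt_of_entry_ne hp
    rw [hφ] at hp'
    obtain ⟨φ₁, C, φ₂, hd, h1, h2⟩ := φ.exists_clause_of_lt hp'
    obtain ⟨j, rfl⟩ := Nat.exists_eq_add_of_le h1
    have hj : j < C.length := by
      rcases Nat.lt_or_ge j C.length with h | h
      · exact h
      · obtain rfl : j = C.length := by omega
        exact absurd (entry_end hφ hd) hp
    refine ⟨C[j], ⟨C, by simp [hd], List.getElem_mem _⟩, ?_⟩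
    unfold variableAt
    rw [entry_literal hφ hd hj, Literal.code_var]

/-! ## Satisfying assignments as increasing sequences of positions -/

/-- The sequence lists the successors of the first positions of the true variables of a satisfying
assignment, between `0` and two numbers beyond all positions. -/
structure IsChain (i : Source) (s : ℕ → ℕ) : Prop where
  zero : s 0 = 0
  last : s (i.param + 1) = i.list.length + 1
  last' : s (i.param + 2) = i.list.length + 2
  lt : ∀ t ≤ i.param + 1, s t < s (t + 1)
  first : ∀ t, 0 < t → t ≤ i.param → i.First (s t - 1)
  sat : ∀ z < i.list.length, i.entry z = 0 → ∃ q < z, (∀ y, q ≤ y → y < z → i.entry y ≠ 0) ∧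
    ∀ t ≤ i.param + 1, ¬i.Falsified (s t) (s (t + 1)) q

/-- Enumerate the first positions of the true variables in increasing order. The true literal of a
clause is falsified by no slot: no true variable lies strictly inside a gap, and every inner member
of the sequence belongs to a true variable. -/
theorem exists_isChain_of_satisfies {φ : CNF} (hφ : i.list = φ.encode) {S : Finset ℕ}
    (hS : S ⊆ φ.vars) (hcard : S.card = i.param) (hsat : φ.Satisfies S) : ∃ s, i.IsChain s := by
  classical
  let P : Finset ℕ := (Finset.range i.list.length).filter
    fun p => i.First p ∧ i.variableAt p ∈ S
  have hmem : ∀ {p}, i.First p → i.variableAt p ∈ S → p ∈ P := fun h h' =>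
    Finset.mem_filter.2 ⟨Finset.mem_range.2 (lt_of_entry_ne h.1), h, h'⟩
  have hPS : P.image i.variableAt = S := by
    ext x
    constructor
    · intro hx
      obtain ⟨p, hp, rfl⟩ := Finset.mem_image.1 hx
      exact (Finset.mem_filter.1 hp).2.2
    · intro hx
      obtain ⟨q, hq, rfl⟩ := (mem_vars_iff hφ).1 (hS hx)
      obtain ⟨p, hp, hpq⟩ := exists_first hq
      have h : i.variableAt p = i.variableAt q := hpq.2.2
      exact Finset.mem_image.2 ⟨p, hmem hp (h ▸ hx), h⟩
  have hP : P.card = i.param := by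
    rw [← hcard, ← hPS, Finset.card_image_of_injOn]
    intro p hp q hq h
    exact (Finset.mem_filter.1 hp).2.1.eq_of_variableAt_eq (Finset.mem_filter.1 hq).2.1 h
  let s : ℕ → ℕ := fun t => if t = 0 then 0 else
    if h : t - 1 < i.param then P.orderEmbOfFin hP ⟨t - 1, h⟩ + 1 else i.list.length + (t - i.param)
  have s_mid : ∀ t (h : t < i.param), s (t + 1) = P.orderEmbOfFin hP ⟨t, h⟩ + 1 := fun t h => by
    simp [s, h]
  have s_big : ∀ t, i.param ≤ t → s (t + 1) = i.list.length + (t + 1 - i.param) := fun t h => by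
    simp [s, h]
  have s_mem : ∀ t, t < i.param → s (t + 1) - 1 ∈ P := fun t h => by
    rw [s_mid t h, Nat.add_sub_cancel]; exact Finset.orderEmbOfFin_mem _ _ _
  have hmono : StrictMono s := by
    refine strictMono_nat_of_lt_succ fun t => ?_
    cases t with
    | zero =>
      have h0 : s 0 = 0 := rfl
      rw [h0]
      by_cases h : 0 < i.param
      · rw [s_mid 0 h]; omega
      · rw [s_big 0 (by omega)]; omega
    | succ t =>
      by_cases h : t + 1 < i.param
      · rw [s_mid t (by omega), s_mid (t + 1) h, add_lt_add_iff_right]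
        exact (P.orderEmbOfFin hP).strictMono (by simp)
      · rw [s_big (t + 1) (by omega)]
        by_cases h' : t < i.param
        · have := Finset.mem_range.1 (Finset.mem_filter.1 (s_mem t h')).1
          omega
        · rw [s_big t (by omega)]; omega
  refine ⟨s, rfl, by rw [s_big _ le_rfl]; omega, by rw [s_big _ (by omega)]; omega,
    fun t _ => hmono (by omega), fun t h0 ht => ?_, fun z hz hz0 => ?_⟩
  · obtain ⟨t, rfl⟩ := Nat.exists_eq_succ_of_ne_zero h0.ne'
    exact (Finset.mem_filter.1 (s_mem t ht)).2.1
  · rw [hφ] at hz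
    obtain ⟨φ₁, C, φ₂, hd, h1, h2⟩ := φ.exists_clause_of_lt hz
    have hzeq : z = φ₁.encode.length + C.length := by
      by_contra hne
      obtain ⟨j, rfl⟩ := Nat.exists_eq_add_of_le h1
      rw [entry_literal hφ hd (by omega)] at hz0
      exact Literal.code_pos _ hz0
    obtain ⟨l, hl, hholds⟩ := hsat C (by simp [hd])
    obtain ⟨j, hj, rfl⟩ := List.getElem_of_mem hl
    refine ⟨φ₁.encode.length + j, by omega, fun y hy hyz => ?_, fun t ht hf => ?_⟩
    · obtain ⟨m, rfl⟩ := Nat.exists_eq_add_of_le (show φ₁.encode.length ≤ y by omega)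
      rw [entry_literal hφ hd (by omega)]
      exact Literal.code_pos _
    · have hv : i.variableAt (φ₁.encode.length + j) = C[j].1 := by
        unfold variableAt; rw [entry_literal hφ hd hj, Literal.code_var]
      unfold Falsified at hf
      rw [entry_literal hφ hd hj, Literal.code_mod_two] at hf
      unfold Literal.Holds at hholds
      rcases hf with ⟨hs, p, _, hp, hpq, hlt, hlt'⟩ | ⟨hs, hpos, hsame⟩
      · have hs : C[j].2 = true := by by_contra h; simp [h] at hs
        have hpS : p ∈ P := hmem hp (by
          have h : i.variableAt p = _ := hpq.2.2
          rw [h]; change i.variableAt _ ∈ S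
          rw [hv]; exact hholds.2 hs)
        have hr := Finset.range_orderEmbOfFin P hP
        obtain ⟨⟨m, hm⟩, hm'⟩ : p ∈ Set.range (P.orderEmbOfFin hP) := by rw [hr]; exact hpS
        have h := s_mid m hm
        rw [hm'] at h
        rw [← h] at hlt hlt'
        have := hmono.lt_iff_lt.1 hlt
        have := hmono.lt_iff_lt.1 hlt'
        omega
      · have hs : ¬C[j].2 = true := by intro h; simp [h] at hs
        obtain ⟨t, rfl⟩ : ∃ m, t = m + 1 := by
          refine Nat.exists_eq_succ_of_ne_zero ?_
          rintro rfl
          exact absurd hpos (lt_irrefl _)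
        by_cases htk : t < i.param
        · have h1 := (Finset.mem_filter.1 (s_mem t htk)).2.2
          have h2 : i.variableAt (s (t + 1) - 1) = _ := hsame.2.2
          rw [h2] at h1
          change i.variableAt _ ∈ S at h1
          rw [hv] at h1
          exact hs (hholds.1 h1)
        -- This member of the sequence lies beyond the input, where there is no literal.
        · refine hsame.1 (entry_of_le ?_)
          rw [s_big t (by omega)]; omega

theorem IsChain.strictMono {s : ℕ → ℕ} (h : i.IsChain s) {t t' : ℕ} (ht : t ≤ i.param + 2)
    (htt' : t' < t) : s t' < s t := by
  induction t with
  | zero => omega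
  | succ t ih =>
    have := h.lt t (by omega)
    rcases Nat.lt_succ_iff_lt_or_eq.1 htt' with h' | rfl
    · exact (ih (by omega) h').trans this
    · exact this

/-- Make true the variables at the inner members of the sequence. A false literal would be falsified
by a slot: a negative one by the slot starting at its variable, a positive one by the gap containing
it. -/
theorem IsChain.satisfies {s : ℕ → ℕ} (h : i.IsChain s) {φ : CNF} (hφ : i.list = φ.encode) :
    ∃ S ⊆ φ.vars, S.card = i.param ∧ φ.Satisfies S := by
  classical
  have hmono : ∀ t ≤ i.param + 2, ∀ t' < t, s t' < s t := fun _ ht _ => h.strictMono ht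
  have hpos : ∀ t, 0 < t → t ≤ i.param + 2 → 0 < s t := fun t h0 ht =>
    (Nat.zero_le _).trans_lt (hmono t ht 0 h0)
  let S := (Finset.Icc 1 i.param).image fun t => i.variableAt (s t - 1)
  refine ⟨S, fun x hx => ?_, ?_, fun C hC => ?_⟩
  · obtain ⟨t, ht, rfl⟩ := Finset.mem_image.1 hx
    obtain ⟨h1, h2⟩ := Finset.mem_Icc.1 ht
    exact (mem_vars_iff hφ).2 ⟨_, (h.first t h1 h2).1, rfl⟩
  · rw [Finset.card_image_of_injOn, Nat.card_Icc, Nat.add_sub_cancel]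
    intro t ht t' ht' heq
    obtain ⟨h1, h2⟩ := Finset.mem_Icc.1 ht
    obtain ⟨h1', h2'⟩ := Finset.mem_Icc.1 ht'
    have := (h.first t h1 h2).eq_of_variableAt_eq (h.first t' h1' h2') heq
    have hp := hpos t h1 (by omega)
    have hp' := hpos t' h1' (by omega)
    rcases lt_trichotomy t t' with hlt | rfl | hlt
    · have := hmono t' (by omega) t hlt; omega
    · rfl
    · have := hmono t (by omega) t' hlt; omega
  · obtain ⟨φ₁, φ₂, hd⟩ := CNF.exists_eq_append hC
    obtain ⟨q, hq, hblock, hnf⟩ := h.sat _ (end_lt hφ hd) (entry_end hφ hd)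
    have hqge : φ₁.encode.length ≤ q := by
      by_contra! hlt
      exact hblock (φ₁.encode.length - 1) (by omega) (by omega) (entry_before hφ hd (by omega))
    obtain ⟨j, rfl⟩ := Nat.exists_eq_add_of_le hqge
    have hj : j < C.length := by omega
    refine ⟨C[j], List.getElem_mem _, ?_⟩
    have hv : i.variableAt (φ₁.encode.length + j) = C[j].1 := by
      unfold variableAt; rw [entry_literal hφ hd hj, Literal.code_var]
    have hne : i.entry (φ₁.encode.length + j) ≠ 0 := by
      rw [entry_literal hφ hd hj]; exact Literal.code_pos _
    have hmod : i.entry (φ₁.encode.length + j) % 2 = if C[j].2 = true then 1 else 0 := by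
      rw [entry_literal hφ hd hj, Literal.code_mod_two]
    unfold Literal.Holds
    by_cases hsign : C[j].2 = true
    · simp only [hsign, iff_true]
      by_contra hnS
      obtain ⟨p, hp, hpq⟩ := exists_first hne
      have hpN := lt_of_entry_ne hp.1
      have hpS : ∀ t, 1 ≤ t → t ≤ i.param → s t ≠ p + 1 := by
        intro t h1 h2 heq
        refine hnS (Finset.mem_image.2 ⟨t, Finset.mem_Icc.2 ⟨h1, h2⟩, ?_⟩)
        rw [heq, Nat.add_sub_cancel, ← hv]
        exact hpq.2.2
      -- This selects the gap around `p`. The member `s (i.param + 1)` lies beyond all positions, so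
      -- the gap ends, and `hpS` excludes that it ends at `p + 1` itself.
      let t := Nat.findGreatest (fun t => s t < p + 1) (i.param + 1)
      have ht : s t < p + 1 := Nat.findGreatest_spec (P := fun t => s t < p + 1) (m := 0)
        (by omega) (by rw [h.zero]; omega)
      have htle : t ≤ i.param + 1 := Nat.findGreatest_le _
      have htk : t ≤ i.param := by
        rcases Nat.lt_or_ge i.param t with h' | h'
        · have : t = i.param + 1 := by omega
          rw [this, h.last] at ht; omega
        · exact h'
      have ht' : ¬s (t + 1) < p + 1 :=
        Nat.findGreatest_is_greatest (P := fun t => s t < p + 1) (Nat.lt_succ_self t) (by omega)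
      refine hnf t htle (.inl ⟨by rw [hmod, if_pos hsign], p, hpN, hp, hpq, ht, ?_⟩)
      refine lt_of_le_of_ne (by omega) fun heq => ?_
      by_cases h' : t + 1 ≤ i.param
      · exact hpS (t + 1) (by omega) h' heq.symm
      · have : t = i.param := by omega
        rw [this, h.last] at heq; omega
    · simp only [hsign]
      refine iff_of_false (fun hS => ?_) (by simp)
      obtain ⟨t, ht, heq⟩ := Finset.mem_image.1 hS
      obtain ⟨h1, h2⟩ := Finset.mem_Icc.1 ht
      refine hnf t (by omega) (.inr ⟨by rw [hmod, if_neg hsign], hpos t h1 (by omega), ?_⟩)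
      exact ⟨(h.first t h1 h2).1, hne, heq.trans hv.symm⟩

theorem mem_weightedSat_iff : (i.list, i.param) ∈ WeightedSat d ↔
    ¬i.Malformed d ∧ ∃ s, i.IsChain s := by
  rw [not_malformed_iff]
  constructor
  · rintro ⟨φ, hφ, hC, S, hS, hcard, hsat⟩
    exact ⟨⟨φ, hφ, hC⟩, exists_isChain_of_satisfies hφ hS hcard hsat⟩
  · rintro ⟨⟨φ, hφ, hC⟩, s, hs⟩
    obtain ⟨S, hS, hcard, hsat⟩ := hs.satisfies hφ
    exact ⟨φ, hφ, hC, S, hS, hcard, hsat⟩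

end Source

/-! ### Cliques of slot tuples -/

theorem exists_digits {W L : ℕ} (δ : ℕ → ℕ) (hδ : ∀ m < L, δ m < W) :
    ∃ v < W ^ L, ∀ m < L, v / W ^ m % W = δ m := by
  let g : Fin L → Fin W := fun m => ⟨δ m, hδ m m.2⟩
  refine ⟨finFunctionFinEquiv g, (finFunctionFinEquiv g).2, fun m hm => ?_⟩
  have h := congrFun (finFunctionFinEquiv.symm_apply_apply g) ⟨m, hm⟩
  exact congrArg Fin.val h

theorem eq_of_digits_eq {W L u v : ℕ} (hu : u < W ^ L) (hv : v < W ^ L)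
    (h : ∀ m < L, u / W ^ m % W = v / W ^ m % W) : u = v := by
  have : (⟨u, hu⟩ : Fin (W ^ L)) = ⟨v, hv⟩ := finFunctionFinEquiv.symm.injective
    (funext fun m => Fin.ext (h m m.2))
  exact congrArg Fin.val this

namespace Source
variable {i : Source} {d : ℕ}

theorem Adj.symm {u v : ℕ} (h : i.Adj d u v) : i.Adj d v u :=
  ⟨h.2.1, h.1, h.2.2.1.symm, h.2.2.2.2.1, h.2.2.2.1, h.2.2.2.2.2.2, h.2.2.2.2.2.1⟩

theorem IsChain.le {s : ℕ → ℕ} (h : i.IsChain s) {t : ℕ} (ht : t ≤ i.param + 2) :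
    s t ≤ i.list.length + 2 := by
  rw [← h.last']
  rcases ht.lt_or_eq with h' | rfl
  · exact (h.strictMono le_rfl h').le
  · exact le_rfl

/-- The digits of the code of the tuple of slots with numbers `τ`. -/
def slotDigit (s : ℕ → ℕ) (τ : ℕ → ℕ) (m : ℕ) : ℕ :=
  if m % 3 = 0 then τ (m / 3) else if m % 3 = 1 then s (τ (m / 3)) else s (τ (m / 3) + 1)

theorem IsChain.exists_code {s : ℕ → ℕ} (h : i.IsChain s) (d : ℕ) (τ : ℕ → ℕ)
    (hτ : ∀ j, τ j ≤ i.param + 1) : ∃ v < i.order d, ∀ j < d + 1, i.digit (3 * j) v = τ j ∧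
      i.digit (3 * j + 1) v = s (τ j) ∧ i.digit (3 * j + 2) v = s (τ j + 1) := by
  obtain ⟨v, hv, hd⟩ := exists_digits (W := i.width) (L := 3 * (d + 1)) (slotDigit s τ) (by
    intro m _
    have h1 := hτ (m / 3)
    have h2 := h.le (t := τ (m / 3)) (by omega)
    have h3 := h.le (t := τ (m / 3) + 1) (by omega)
    unfold slotDigit width
    split_ifs <;> omega)
  refine ⟨v, hv, fun j hj => ⟨(hd _ (by omega)).trans ?_, (hd _ (by omega)).trans ?_,
    (hd _ (by omega)).trans ?_⟩⟩ <;> unfold slotDigit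
  · simp
  · rw [if_neg (by omega), if_pos (by omega), show (3 * j + 1) / 3 = j by omega]
  · rw [if_neg (by omega), if_neg (by omega), show (3 * j + 2) / 3 = j by omega]

/-- All slots of one sequence agree and none of them falsifies the chosen literal of a clause, so
every tuple of slot numbers yields a vertex, and any two of these are adjacent. -/
theorem IsChain.exists_clique {s : ℕ → ℕ} (h : i.IsChain s) (hm : ¬i.Malformed d) :
    ∃ U : Finset ℕ, U.card = i.cliqueSize d ∧ (∀ u ∈ U, u < i.order d) ∧
      ∀ u ∈ U, ∀ v ∈ U, u ≠ v → i.Adj d u v := by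
  classical
  let ext : (Fin (d + 1) → Fin (i.param + 2)) → ℕ → ℕ := fun τ j =>
    if hj : j < d + 1 then τ ⟨j, hj⟩ else 0
  have hext : ∀ τ j, ext τ j ≤ i.param + 1 := fun τ j => by
    simp only [ext]; split_ifs
    · omega
    · omega
  choose code hlt hcode using fun τ => h.exists_code d (ext τ) (hext τ)
  have hinj : Function.Injective code := by
    intro τ τ' heq
    ext j
    have h1 := (hcode τ j j.2).1
    rw [heq, (hcode τ' j j.2).1] at h1
    simp only [ext, j.2, dif_pos] at h1
    exact h1.symm
  have hcompat : ∀ τ τ', i.Compat d (code τ) (code τ') := by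
    intro τ τ' j hj l hl
    unfold Link
    obtain ⟨h1, h2, h3⟩ := hcode τ j hj
    obtain ⟨h1', h2', h3'⟩ := hcode τ' l hl
    rw [h1, h2, h3, h1', h2', h3']
    exact ⟨fun heq => by rw [heq]; exact ⟨rfl, rfl⟩, fun heq => by rw [heq]⟩
  have hnode : ∀ τ, i.Node d (code τ) := by
    intro τ
    refine ⟨hm, hcompat τ τ, fun j hj => ?_, ?_⟩
    · obtain ⟨h1, h2, h3⟩ := hcode τ j hj
      have hle := hext τ j
      rw [h1, h2, h3]
      refine ⟨hle, h.lt _ hle, h.le (by omega), fun h0 => by rw [h0, h.zero], fun h0 h1 => ?_,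
        fun h1 => by rw [h1, h.last]⟩
      exact ⟨(Nat.zero_le _).trans_lt (h.strictMono (by omega) h0), h.first _ h0 h1⟩
    · rintro ⟨z, hz, hz0, hall⟩
      obtain ⟨q, hq, hblock, hnf⟩ := h.sat z hz hz0
      rcases hall q (by omega) hq with ⟨y, _, hyz, hqy, hy⟩ | ⟨j, hj, hf⟩
      · exact hblock y hqy hyz hy
      · obtain ⟨_, h2, h3⟩ := hcode τ j hj
        rw [h2, h3] at hf
        exact hnf _ (hext τ j) hf
  refine ⟨Finset.univ.image code, ?_, fun u hu => ?_, fun u hu v hv huv => ?_⟩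
  · rw [Finset.card_image_of_injective _ hinj, Finset.card_univ, Fintype.card_fun, Fintype.card_fin,
      Fintype.card_fin]
    rfl
  · obtain ⟨τ, _, rfl⟩ := Finset.mem_image.1 hu
    exact hlt τ
  · obtain ⟨τ, _, rfl⟩ := Finset.mem_image.1 hu
    obtain ⟨τ', _, rfl⟩ := Finset.mem_image.1 hv
    exact ⟨hlt τ, hlt τ', huv, hnode τ, hnode τ', hcompat τ τ', hcompat τ' τ⟩

theorem two_le_cliqueSize (i : Source) (d : ℕ) : 2 ≤ i.cliqueSize d :=
  (by omega : 2 ≤ i.param + 2).trans (Nat.le_self_pow (by simp) _)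

/-- Compatible vertices with equal slot numbers coincide, so by counting every tuple of numbers
occurs. Compatibility glues the slots into one sequence. If that violated a clause, the vertex
collecting slots that falsify its literals would be refuted. -/
theorem exists_isChain_of_clique {U : Finset ℕ} (hU : U.card = i.cliqueSize d)
    (hcl : ∀ u ∈ U, ∀ v ∈ U, u ≠ v → i.Adj d u v) : ¬i.Malformed d ∧ ∃ s, i.IsChain s := by
  classical
  have hnode : ∀ u ∈ U, u < i.order d ∧ i.Node d u := by
    intro u hu
    -- Being a vertex of the graph is recorded only in adjacency, so a second member of `U` is
    -- needed; this is why the clique size is at least two.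
    obtain ⟨v, hv, hne⟩ := Finset.exists_mem_ne
      (by have := i.two_le_cliqueSize d; omega : 1 < U.card) u
    have := hcl u hu v hv hne.symm
    exact ⟨this.1, this.2.2.2.1⟩
  have hcompat : ∀ u ∈ U, ∀ v ∈ U, i.Compat d u v := by
    intro u hu v hv
    by_cases h : u = v
    · subst h; exact (hnode u hu).2.2.1
    · exact (hcl u hu v hv h).2.2.2.2.2.1
  have hm : ¬i.Malformed d := by
    obtain ⟨u, hu⟩ := Finset.card_pos.1 (by have := i.two_le_cliqueSize d; omega : 0 < U.card)
    exact (hnode u hu).2.1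
  refine ⟨hm, ?_⟩
  have hslot : ∀ u ∈ U, ∀ j < d + 1, i.SlotOk (i.digit (3 * j) u) (i.digit (3 * j + 1) u)
      (i.digit (3 * j + 2) u) := fun u hu => (hnode u hu).2.2.2.1
  let index : U → Fin (d + 1) → Fin (i.param + 2) := fun u j =>
    ⟨i.digit (3 * j) u, by have := (hslot u u.2 j j.2).1; omega⟩
  have hinj : Function.Injective index := by
    intro u v huv
    refine Subtype.ext (eq_of_digits_eq (hnode u u.2).1 (hnode v v.2).1 fun m hm => ?_)
    have hj : m / 3 < d + 1 := by omega
    have h0 : i.digit (3 * (m / 3)) u = i.digit (3 * (m / 3)) v :=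
      congrArg Fin.val (congrFun huv ⟨m / 3, hj⟩)
    obtain ⟨h1, h2⟩ := (hcompat u u.2 v v.2 _ hj _ hj).1 h0
    change i.digit m u = i.digit m v
    have : m = 3 * (m / 3) ∨ m = 3 * (m / 3) + 1 ∨ m = 3 * (m / 3) + 2 := by omega
    rcases this with h | h | h <;> rw [h] <;> assumption
  have hsurj : Function.Surjective index := by
    refine ((Fintype.bijective_iff_injective_and_card index).2 ⟨hinj, ?_⟩).2
    rw [Fintype.card_coe, hU, Fintype.card_fun, Fintype.card_fin, Fintype.card_fin]
    rfl
  have hex : ∀ τ : ℕ → ℕ, (∀ j, τ j ≤ i.param + 1) →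
      ∃ u ∈ U, ∀ j < d + 1, i.digit (3 * j) u = τ j := by
    intro τ hτ
    obtain ⟨u, hu⟩ := hsurj fun j => ⟨τ j, by have := hτ j; omega⟩
    exact ⟨u, u.2, fun j hj => congrArg Fin.val (congrFun hu ⟨j, hj⟩)⟩
  -- The vertices with constant slot numbers serve as reference for the values of `s`.
  choose! g hgU hg using fun t (ht : t ≤ i.param + 1) => hex (fun _ => t) fun _ => ht
  let s : ℕ → ℕ := fun t => if t ≤ i.param + 1 then i.digit 1 (g t) else i.list.length + 2
  have hs : ∀ t ≤ i.param + 1, s t = i.digit (3 * 0 + 1) (g t) := fun t ht => if_pos ht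
  have hg0 : ∀ t ≤ i.param + 1, i.digit (3 * 0) (g t) = t := fun t ht => hg t ht 0 (by omega)
  have hs' : s (i.param + 2) = i.list.length + 2 := if_neg (by omega)
  have hA : ∀ t ≤ i.param + 1, ∀ u ∈ U, ∀ j < d + 1, i.digit (3 * j) u = t →
      i.digit (3 * j + 1) u = s t := by
    intro t ht u hu j hj hut
    rw [hs t ht]
    exact ((hcompat u hu (g t) (hgU t ht) j hj 0 (by omega)).1 (by rw [hut, hg0 t ht])).1
  have hB : ∀ t ≤ i.param + 1, ∀ u ∈ U, ∀ j < d + 1, i.digit (3 * j) u = t →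
      i.digit (3 * j + 2) u = s (t + 1) := by
    intro t ht u hu j hj hut
    by_cases h : t + 1 ≤ i.param + 1
    · rw [hs _ h]
      exact (hcompat u hu (g (t + 1)) (hgU _ h) j hj 0 (by omega)).2 (by rw [hut, hg0 _ h])
    -- The last slot has no successor to be linked with, but it starts at `length + 1` and its end
    -- is at most `length + 2`.
    · obtain ⟨_, h1, h2, _, _, h3⟩ := hslot u hu j hj
      have := h3 (by omega)
      rw [show t + 1 = i.param + 2 by omega, hs']
      omega
  have hok : ∀ t ≤ i.param + 1, i.SlotOk t (s t) (s (t + 1)) := by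
    intro t ht
    have h := hslot (g t) (hgU t ht) 0 (by omega)
    rwa [hA t ht _ (hgU t ht) 0 (by omega) (hg0 t ht), hB t ht _ (hgU t ht) 0 (by omega) (hg0 t ht),
      hg0 t ht] at h
  refine ⟨s, (hok 0 (by omega)).2.2.2.1 rfl, (hok _ le_rfl).2.2.2.2.2 rfl, hs',
    fun t ht => (hok t ht).2.1, fun t h0 ht => ((hok t (by omega)).2.2.2.2.1 h0 ht).2, ?_⟩
  intro z hz hz0
  by_contra! hno
  -- Coordinate `j` takes care of the literal `j + 1` places before the end of the violated clause,
  -- which has at most `d` literals. Coordinates without such a literal may hold any number.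
  let τ : ℕ → ℕ := fun j =>
    if h : ∃ t ≤ i.param + 1, i.Falsified (s t) (s (t + 1)) (z - 1 - j) then h.choose else 0
  have hτ : ∀ j, τ j ≤ i.param + 1 := by
    intro j
    simp only [τ]
    split_ifs with h
    · exact h.choose_spec.1
    · omega
  obtain ⟨u, hu, hdig⟩ := hex τ hτ
  refine (hnode u hu).2.2.2.2 ⟨z, hz, hz0, fun q hqN hq => ?_⟩
  by_cases hblock : ∀ y, q ≤ y → y < z → i.entry y ≠ 0
  · right
    obtain hf := hno q hq hblock
    have hlen : z - q < d + 1 := by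
      by_contra! hlen
      exact hm (.inr ⟨q, hqN, fun j hj => hblock _ (by omega) (by omega)⟩)
    refine ⟨z - 1 - q, by omega, ?_⟩
    have hj : z - 1 - q < d + 1 := by omega
    have hq' : z - 1 - (z - 1 - q) = q := by omega
    have hτq : i.Falsified (s (τ (z - 1 - q))) (s (τ (z - 1 - q) + 1)) q := by
      have h : ∃ t ≤ i.param + 1, i.Falsified (s t) (s (t + 1)) (z - 1 - (z - 1 - q)) := by
        rw [hq']; exact hf
      have h2 := h.choose_spec.2
      have h3 : τ (z - 1 - q) = h.choose := dif_pos h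
      rw [← h3] at h2
      rwa [hq'] at h2
    rw [hA _ (hτ _) u hu _ hj (hdig _ hj), hB _ (hτ _) u hu _ hj (hdig _ hj)]
    exact hτq
  · left
    push Not at hblock
    obtain ⟨y, h1, h2, h3⟩ := hblock
    exact ⟨y, by omega, h2, h1, h3⟩

theorem mem_weightedSat_iff_clique : (i.list, i.param) ∈ WeightedSat d ↔
    ∃ U : Finset ℕ, U.card = i.cliqueSize d ∧ (∀ u ∈ U, u < i.order d) ∧
      ∀ u ∈ U, ∀ v ∈ U, u ≠ v → i.Adj d u v := by
  rw [mem_weightedSat_iff]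
  exact ⟨fun ⟨hm, s, hs⟩ => hs.exists_clique hm, fun ⟨U, hU, _, hcl⟩ =>
    exists_isChain_of_clique hU hcl⟩

/-! ## The most vital edges instance -/

theorem adj_irrefl (u : ℕ) : ¬i.Adj d u u := fun h => h.2.2.1 rfl

theorem budget_le (i : Source) (d : ℕ) :
    budget (i.order d ^ 3) (i.cliqueSize d) ≤ i.order d ^ 4 := by
  unfold budget
  calc _ ≤ i.cliqueSize d * i.order d ^ 3 := Nat.sub_le _ _
    _ ≤ i.order d * i.order d ^ 3 := Nat.mul_le_mul_right _ (i.cliqueSize_le_order d)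
    _ = _ := by ring

theorem budget_pos (i : Source) (d : ℕ) : 0 < budget (i.order d ^ 3) (i.cliqueSize d) := by
  unfold budget
  have h1 := i.cliqueSize_le_order d
  have h2 := i.two_le_cliqueSize d
  have h3 : i.order d ≤ i.order d ^ 3 := Nat.le_self_pow (by simp) _
  have h4 : i.cliqueSize d * (i.cliqueSize d - 1) ≤ i.cliqueSize d * i.order d ^ 3 :=
    Nat.mul_le_mul_left _ (by omega)
  have h5 : 0 < i.cliqueSize d * i.order d ^ 3 := Nat.mul_pos (by omega) (by omega)
  omega

/-- The most vital edges instance that is equivalent to the weighted satisfiability instance. -/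
noncomputable def instanceOf (i : Source) (d : ℕ) : MVEInput where
  n := i.vertices d
  n_pos := i.vertices_pos d
  graph := ⊤
  weight e := ind (e ∉ (zeroGraph (i.order d) (i.order d ^ 3) (i.vertices d) (i.Adj d)
    fun _ _ => Adj.symm).edgeSet)
  b := budget (i.order d ^ 3) (i.cliqueSize d)
  b_pos := i.budget_pos d
  r := i.cliqueSize d
  r_pos := by have := i.two_le_cliqueSize d; omega

/-- The choice `D = n ^ 3` makes the padding outweigh the at most `n` original neighbors, and `n ^
5` vertices exceed the budget, which is at most `n ^ 4`, by enough to keep the large clique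
connected. -/
theorem instanceOf_isYes_iff : (i.instanceOf d).IsYes ↔ (i.list, i.param) ∈ WeightedSat d := by
  rw [mem_weightedSat_iff_clique]
  have hn := i.two_le_order d
  set n := i.order d with hn'
  have hlt : ∀ u v, i.Adj d u v → u < n ∧ v < n := fun u v h => ⟨h.1, h.2.1⟩
  have hnD : n ≤ n ^ 3 := Nat.le_self_pow (by simp) _
  have h3 : n ^ 3 = n * n * n := by ring
  have h4 : n ^ 4 = n * n ^ 3 := by ring
  have h5 : i.vertices d = n * n ^ 4 := by unfold vertices; rw [← hn']; ring
  have hbl := i.budget_le d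
  rw [← hn'] at hbl
  have hnn : 2 * n ≤ n * n := Nat.mul_le_mul_right _ hn
  have hn3 : 2 * (n * n) ≤ n ^ 3 := by rw [h3]; nlinarith
  have hn4 : 2 * n ^ 3 ≤ n ^ 4 := by rw [h4]; exact Nat.mul_le_mul_right _ hn
  have hn5 : 2 * n ^ 4 ≤ n * n ^ 4 := Nat.mul_le_mul_right _ hn
  have hN : n + n ^ 3 ≤ i.vertices d ∧ n ^ 4 + n + 2 ≤ i.vertices d := by
    rw [h5]; omega
  clear h3 h4 h5
  constructor
  · rintro ⟨I, _, hI, hw⟩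
    refine clique_of_deletion (fun _ _ => Adj.symm) hlt adj_irrefl hnD hN.1 ?_ ?_ hI hw
    · exact le_trans (by omega) hN.2
    · have hk := i.cliqueSize_le_order d
      rw [← hn'] at hk
      have h6 : (i.cliqueSize d + 1) * (n ^ 3 - n) + (i.cliqueSize d + 1) * n =
          (i.cliqueSize d + 1) * n ^ 3 := by rw [← Nat.mul_add, Nat.sub_add_cancel hnD]
      have h7 : (i.cliqueSize d + 1) * n ≤ (n + 1) * n := Nat.mul_le_mul_right _ (by omega)
      have h8 : (n + 1) * n = n * n + n := by ring
      have h9 : (i.cliqueSize d + 1) * n ^ 3 = i.cliqueSize d * n ^ 3 + n ^ 3 := by ring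
      have h10 : budget (n ^ 3) (i.cliqueSize d) ≤ i.cliqueSize d * n ^ 3 - 1 := by
        have h2 := i.two_le_cliqueSize d
        have : 2 * 1 ≤ i.cliqueSize d * (i.cliqueSize d - 1) := Nat.mul_le_mul h2 (by omega)
        unfold budget; omega
      omega
  · rintro ⟨U, hU, hUn, hcl⟩
    exact exists_deletion_of_clique (fun _ _ => Adj.symm) hlt hnD
      (lt_of_lt_of_le (by omega) hN.1) hU hUn hcl

theorem matrix_eq (i : Source) (d : ℕ) (u v : Fin (i.vertices d))
    [Decidable ((i.instanceOf d).graph.Adj u v)] :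
    i.matrix d u v = if (i.instanceOf d).graph.Adj u v then (i.instanceOf d).weight s(u, v) + 1
      else 0 := by
  have h : (i.instanceOf d).graph.Adj u v ↔ u ≠ v := Iff.rfl
  unfold matrix
  by_cases huv : u = v
  · rw [if_pos (congrArg Fin.val huv), if_neg fun h' => h.1 h' huv]
  · rw [if_neg fun h' => huv (Fin.ext h'), if_pos (h.2 huv)]
    change _ = ind (s(u, v) ∉ (zeroGraph _ _ _ _ _).edgeSet) + 1
    rw [SimpleGraph.mem_edgeSet, zeroGraph_adj]
    by_cases hz : ZeroEdge (i.order d) (i.order d ^ 3) (i.Adj d) u v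
    · rw [if_pos hz, ind_of_not fun h' => h' ⟨huv, hz⟩]
    · rw [if_neg hz, ind_of fun h' => hz h'.2]

theorem flatMap_finRange_eq {n : ℕ} (f : ℕ → ℕ → ℕ) :
    ((List.finRange n).flatMap fun u : Fin n => (List.finRange n).map fun v : Fin n => f u v) =
      (List.range (n * n)).map fun j => f (j / n) (j % n) := by
  have h : ∀ m, ((List.range m).flatMap fun u => (List.range n).map fun v => f u v) =
      (List.range (m * n)).map fun j => f (j / n) (j % n) := by
    intro m
    induction m with
    | zero => simp
    | succ m ih =>
      rw [List.range_succ, List.flatMap_append, ih, Nat.succ_mul, List.range_add, List.map_append]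
      simp only [List.flatMap_cons, List.flatMap_nil, List.append_nil, List.map_map]
      congr 1
      refine List.map_congr_left fun v hv => ?_
      have hv := List.mem_range.1 hv
      have hn : 0 < n := by omega
      simp only [Function.comp_apply]
      rw [Nat.mul_comm m n, Nat.mul_add_div hn, Nat.mul_add_mod, Nat.div_eq_of_lt hv,
        Nat.mod_eq_of_lt hv, Nat.add_zero]
  rw [← h n, ← List.map_coe_finRange_eq_range, List.flatMap_map]
  simp only [List.map_map]
  rfl

open Classical in
theorem encode_instanceOf (i : Source) (d : ℕ) :
    (i.instanceOf d).encode = (List.range (i.outputLength d)).map (i.output d) := by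
  have h1 : (i.instanceOf d).encode = budget (i.order d ^ 3) (i.cliqueSize d) :: i.cliqueSize d ::
      i.vertices d :: ((List.finRange (i.vertices d)).flatMap fun u : Fin (i.vertices d) =>
        (List.finRange (i.vertices d)).map fun v : Fin (i.vertices d) => i.matrix d u v) := by
    unfold MVEInput.encode
    refine congrArg (fun l => _ :: _ :: _ :: l) ?_
    refine List.flatMap_congr fun u _ => ?_
    exact List.map_congr_left fun v _ => (@matrix_eq i d u v _).symm
  rw [h1, flatMap_finRange_eq]
  unfold outputLength
  rw [List.range_succ_eq_map, List.range_succ_eq_map, List.range_succ_eq_map]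
  simp only [List.map_cons, List.map_map]
  congr 1

end Source

/-! ## The program of the reduction -/

/-- The state presents the input `i`. -/
structure Given (s : State) (i : Source) : Prop where
  length : s.reg 0 = i.list.length
  param : s.reg 1 = i.param
  entry : ∀ j < i.list.length, s.arr 0 j = i.entry j

theorem exists_prepare (d : ℕ) : ∃ p c, ∀ s i, Given s i →
    Runs p s (fun s' => Loaded (loopExp d) s' i ∧ s'.reg 3 = i.outputLength d ∧
      s'.reg 4 = i.cliqueSize d) (i.width ^ c) := by
  -- The loop bound is itself computed by loops, of range `width ^ 1`; it then replaces the width in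
  -- register `2`.
  obtain ⟨p, c₁, hp⟩ := (PC.pow (α := Source) (e := 1) PC.width (loopExp d)
    fun _ _ => by rw [pow_one]) (fun _ => 1) 3 le_rfl (by simp)
  obtain ⟨q, c₂, hq⟩ := (PC.outputLength (α := Source) (d := d)) (fun _ => 1) 3 le_rfl (by simp)
  obtain ⟨r, c₃, hr⟩ := (PC.cliqueSize (α := Source) (d := d)) (fun _ => 1) 4 (by simp) (by simp)
  refine ⟨.seq (.assign 2 (.add (.reg 0) (.add (.reg 1) (.const 3)))) (.seq p
    (.seq (.assign 2 (.reg 3)) (.seq q r))), 6 + (c₁ + (2 + (c₂ + c₃ + 1) + 1) + 1) + 1,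
    fun s i h => ?_⟩
  have hw := i.two_le_width
  refine (Runs.seq (.assign (Q := fun s' => Loaded 1 s' i) ?_) fun s₁ h₁ => ?_).mono (fun _ h => h)
    ((Nat.add_le_add_right (le_pow_self hw 6) _).trans (add_pow_le hw 6 _))
  · refine ⟨by simp [h.length], by simp [h.param], ?_, by simpa using h.entry⟩
    simp [Term.val, h.length, h.param, Source.width, add_assoc]
  refine ((hp s₁ i h₁ trivial fun x => h₁.param).seq fun s₂ h₂ => ?_).mono (fun _ h => h)
    (add_pow_le hw c₁ _)
  obtain ⟨ha, hreg, h3⟩ := h₂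
  have hl₂ : Loaded 1 s₂ i := h₁.of_eq ha hreg
  refine (Runs.seq (.assign (Q := fun s' => Loaded (loopExp d) s' i) ?_) fun s₃ h₃ => ?_).mono
    (fun _ h => h) ((Nat.add_le_add_right (le_pow_self hw 2) _).trans (add_pow_le hw 2 _))
  · exact ⟨by simp [hl₂.length], by simp [hl₂.param], by simp [Term.val, h3]; rfl,
      by simpa using hl₂.entry⟩
  refine ((hq s₃ i h₃ trivial fun x => h₃.param).seq fun s₄ h₄ => ?_).mono (fun _ h => h)
    (add_pow_le hw c₂ c₃)
  obtain ⟨ha, hreg, h3⟩ := h₄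
  have hl₄ : Loaded (loopExp d) s₄ i := h₃.of_eq ha hreg
  refine (hr s₄ i hl₄ trivial fun x => hl₄.param).mono ?_ le_rfl
  rintro s₅ ⟨ha, hreg, h4⟩
  exact ⟨hl₄.of_eq ha fun x hx => hreg x (by omega), (hreg 3 (by simp)).trans h3, h4⟩

/-- The output goes to array `1`, since the input in array `0` is consulted for every entry;
`exists_copy` moves it afterwards. -/
theorem exists_write (d : ℕ) : ∃ p c, ∀ s i, Loaded (loopExp d) s i →
    s.reg 3 = i.outputLength d → s.reg 4 = i.cliqueSize d →
    Runs p s (fun s' => s'.reg 3 = i.outputLength d ∧ s'.reg 4 = i.cliqueSize d ∧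
      ∀ j < i.outputLength d, s'.arr 1 j = i.output d j) (i.width ^ c) := by
  obtain ⟨p, c, hp⟩ := (PC.output (α := Source × ℕ) (d := d) PC.snd fun a ha => ha.2.le)
    (fun x => Nat.casesOn x 5 fun _ => 1) 6 (by simp) (by intro x; cases x <;> simp)
  refine ⟨.seq (.assign 5 (.const 0)) (.loop (.sub (.reg 3) (.reg 5)) (.seq p
    (.seq (.store 1 (.reg 5) (.reg 6)) (.assign 5 (.add (.reg 5) (.const 1)))))),
    loopExp d + (11 + c + 1) + 6 + 1, fun s i hl h3 h4 => ?_⟩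
  have hw := i.two_le_width
  let I : ℕ → State → Prop := fun m s' => Loaded (loopExp d) s' i ∧ s'.reg 3 = i.outputLength d ∧
    s'.reg 4 = i.cliqueSize d ∧ s'.reg 5 = m ∧ ∀ j < m, s'.arr 1 j = i.output d j
  refine (Runs.seq (.assign (Q := I 0) ?_) fun s₁ h₁ => (Runs.loop (T := i.width ^ c + 7)
    (m := i.outputLength d) I (fun m hm s' hs' => ?_) (fun s' hs' => ?_) h₁).mono
    (fun s' hs' => ⟨hs'.2.1, hs'.2.2.1, hs'.2.2.2.2⟩) le_rfl).mono (fun _ h => h) ?_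
  · exact ⟨hl.of_eq rfl fun x hx => by simp [show x ≠ 5 by omega], by simp [h3], by simp [h4],
      by simp [Term.val], fun j hj => by omega⟩
  · obtain ⟨hl', h3, h4, h5, hout⟩ := hs'
    refine ⟨by simp only [Term.val, h3, h5]; omega, ?_⟩
    refine (hp s' (i, m) hl' ⟨trivial, hm.trans_le (i.outputLength_le d)⟩ ?_).seq fun s₂ h₂ => ?_
    · intro x; cases x with
      | zero => exact h5
      | succ x => exact hl'.param
    · obtain ⟨ha, hreg, h6⟩ := h₂
      have hl₂ := hl'.of_eq ha fun x hx => hreg x (by omega)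
      refine (Runs.store (Q := fun s => s = _) rfl).seq (T' := 4) ?_
      rintro _ rfl
      refine .assign ⟨⟨by simp [hl₂.length], by simp [hl₂.param], by simp [hl₂.bound],
        by simpa using hl₂.entry⟩, ?_, ?_, ?_, fun j hj => ?_⟩
      · simp [hreg, h3]
      · simp [hreg, h4]
      · simp [Term.val, hreg, h5]
      · simp only [Term.val, State.setReg_arr, State.setCell_arr, h6, true_and,
          hreg 5 (by simp), h5, ha]
        split_ifs with h
        · rw [h]; rfl
        · exact hout j (by omega)
  · simp only [Term.val, hs'.2.1, hs'.2.2.2.1]; omega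
  · have h1 : 11 + i.width ^ c ≤ i.width ^ (11 + c + 1) :=
      (Nat.add_le_add_right (le_pow_self hw 11) _).trans (add_pow_le hw _ _)
    have h2 := Nat.mul_le_mul (i.outputLength_le d) h1
    rw [← pow_add] at h2
    refine le_trans ?_ ((Nat.add_le_add h2 (le_pow_self hw 6)).trans (add_pow_le hw _ _))
    simp only [Term.cost]
    rw [show 1 + 1 + 1 + 1 + (i.width ^ c + 7) = 11 + i.width ^ c by omega]
    omega

/-- The reduced instance for a formula without empty clauses. -/
noncomputable def Source.image (i : Source) (d : ℕ) : Instance :=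
  ((List.range (i.outputLength d)).map (i.output d), i.cliqueSize d)

theorem exists_copy (d : ℕ) : ∃ p c, ∀ s (i : Source),
    s.reg 3 = i.outputLength d → s.reg 4 = i.cliqueSize d →
    (∀ j < i.outputLength d, s.arr 1 j = i.output d j) →
    Runs p s (fun s' => s'.Presents (i.image d)) (i.width ^ c) := by
  refine ⟨.seq (.assign 5 (.const 0)) (.seq (.loop (.sub (.reg 3) (.reg 5))
    (.seq (.store 0 (.reg 5) (.cell 1 (.reg 5))) (.assign 5 (.add (.reg 5) (.const 1)))))
    (.seq (.assign 0 (.reg 3)) (.assign 1 (.reg 4)))),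
    loopExp d + 12 + 10 + 1, fun s i h3 h4 h => ?_⟩
  have hw := i.two_le_width
  let I : ℕ → State → Prop := fun m s' => s'.reg 3 = i.outputLength d ∧
    s'.reg 4 = i.cliqueSize d ∧ s'.reg 5 = m ∧
    (∀ j < i.outputLength d, s'.arr 1 j = i.output d j) ∧ ∀ j < m, s'.arr 0 j = i.output d j
  refine (Runs.seq (.assign (Q := I 0) ?_) fun s₁ h₁ => (Runs.loop (T := 8)
    (m := i.outputLength d) I (fun m hm s' hs' => ?_) (fun s' hs' => ?_) h₁).seq (T' := 4)
    fun s₂ h₂ => ?_).mono (fun _ h => h) ?_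
  · exact ⟨by simp [h3], by simp [h4], by simp [Term.val], by simpa using h, fun j hj => by omega⟩
  · obtain ⟨h3, h4, h5, hin, hout⟩ := hs'
    refine ⟨by simp only [Term.val, h3, h5]; omega, ?_⟩
    refine (Runs.store (Q := fun s => s = _) rfl).seq (T' := 4) ?_
    rintro _ rfl
    refine .assign ⟨by simp [h3], by simp [h4], by simp [Term.val, h5], by simpa using hin,
      fun j hj => ?_⟩
    simp only [Term.val, State.setReg_arr, State.setCell_arr, h5, true_and]
    split_ifs with hjm
    · rw [hjm]; exact hin m hm
    · exact hout j (by omega)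
  · simp only [Term.val, hs'.1, hs'.2.2.1]; omega
  · obtain ⟨h3, h4, -, -, hout⟩ := h₂
    refine (Runs.assign (Q := fun s => s = _) rfl).seq (T' := 2) ?_
    rintro _ rfl
    refine .assign ⟨by simp [Term.val, h3, Source.image], by simp [Term.val, h4, Source.image],
      fun j hj => ?_⟩
    have hj' : j < i.outputLength d := by simpa [Source.image] using hj
    simp [Source.image, hout j hj', hj']
  · have h2 := Nat.mul_le_mul (i.outputLength_le d) (le_pow_self hw 12)
    rw [← pow_add] at h2
    refine le_trans ?_ ((Nat.add_le_add h2 (le_pow_self hw 10)).trans (add_pow_le hw _ _))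
    simp only [Term.cost]
    omega

theorem exists_construct (d : ℕ) : ∃ p c, ∀ s i, Given s i →
    Runs p s (fun s' => s'.Presents (i.image d)) (i.width ^ c) := by
  obtain ⟨p, c₁, hp⟩ := exists_prepare d
  obtain ⟨q, c₂, hq⟩ := exists_write d
  obtain ⟨r, c₃, hr⟩ := exists_copy d
  refine ⟨.seq p (.seq q r), c₁ + (c₂ + c₃ + 1) + 1, fun s i h => ?_⟩
  have hw := i.two_le_width
  refine ((hp s i h).seq fun s₁ h₁ => ?_).mono (fun _ h => h) (add_pow_le hw _ _)
  refine ((hq s₁ i h₁.1 h₁.2.1 h₁.2.2).seq fun s₂ h₂ => ?_).mono (fun _ h => h) (add_pow_le hw _ _)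
  exact hr s₂ i h₂.1 h₂.2.1 h₂.2.2

/-! ## Searching for an empty clause -/

namespace Source

theorem exists_scanEnd (i : Source) :
    ∃ m, i.list.length ≤ m ∨ i.entry m + i.entry (m - 1) = 0 := ⟨_, .inl le_rfl⟩

/-- The position of the end of the first empty clause, or the length if there is none. -/
def scanEnd (i : Source) : ℕ := Nat.find i.exists_scanEnd

theorem scanEnd_le (i : Source) : i.scanEnd ≤ i.list.length := Nat.find_min' _ (.inl le_rfl)

theorem of_lt_scanEnd {i : Source} {m : ℕ} (h : m < i.scanEnd) :
    m < i.list.length ∧ i.entry m + i.entry (m - 1) ≠ 0 := by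
  have := Nat.find_min i.exists_scanEnd h
  push Not at this
  exact this

theorem not_mem_weightedSat {i : Source} (h : i.scanEnd < i.list.length) (d : ℕ) :
    (i.list, i.param) ∉ WeightedSat d := by
  rw [mem_weightedSat_iff]
  rintro ⟨-, s, hs⟩
  have h0 : i.entry i.scanEnd + i.entry (i.scanEnd - 1) = 0 :=
    (Nat.find_spec i.exists_scanEnd).resolve_left (by unfold scanEnd at h; omega)
  obtain ⟨q, hq, hblock, -⟩ := hs.sat i.scanEnd h (by omega)
  exact hblock (i.scanEnd - 1) (by omega) (by omega) (by omega)

/-- Before the scan stops, each pair of positions `2 * t`, `2 * t + 1` contains a nonzero entry,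
hence an element of `A`. -/
theorem scanEnd_le_of_support {i : Source} (A : Finset ℕ)
    (hA : ∀ j < i.list.length, j ∉ A → i.entry j = 0) : i.scanEnd ≤ 2 * A.card + 1 := by
  have h : (Finset.range (i.scanEnd / 2)).card ≤ A.card := by
    refine Finset.card_le_card_of_injOn (fun t => if 2 * t ∈ A then 2 * t else 2 * t + 1) ?_ ?_
    · intro t ht
      have ht : t < i.scanEnd / 2 := Finset.mem_range.1 ht
      obtain ⟨h1, h2⟩ := of_lt_scanEnd (i := i) (m := 2 * t + 1) (by omega)
      dsimp only
      split_ifs with h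
      · exact h
      · by_contra h'
        refine h2 ?_
        rw [Nat.add_sub_cancel, hA _ h1 h', hA _ (by omega) h]
    · intro t _ t' _ htt'
      dsimp only at htt'
      split_ifs at htt' <;> omega
  rw [Finset.card_range] at h
  omega

/-- The reduced instance; a formula with an empty clause is mapped to an invalid code. -/
noncomputable def target (i : Source) (d : ℕ) : Instance :=
  if i.scanEnd < i.list.length then ([], 0) else i.image d

end Source

/-- The test whether the search for an empty clause has to go on. -/
def scanTest : Term :=
  .sub (.const 1) (.add (.sub (.const 1) (.sub (.reg 0) (.reg 3)))
    (.sub (.const 1) (.add (.cell 0 (.reg 3)) (.cell 0 (.sub (.reg 3) (.const 1))))))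

/-- At position `0` truncated subtraction makes both cells of the test the same one, so an empty
first clause is found as well. -/
theorem runs_scan (s : State) (i : Source) (h : Given s i) :
    Runs (.seq (.assign 3 (.const 0)) (.loop scanTest (.assign 3 (.add (.reg 3) (.const 1))))) s
      (fun s' => Given s' i ∧ s'.reg 3 = i.scanEnd) (24 * i.scanEnd + 24) := by
  let I : ℕ → State → Prop := fun m s' => Given s' i ∧ s'.reg 3 = m
  refine (Runs.seq (.assign (Q := I 0) ?_) fun s₁ h₁ => Runs.loop (T := 4) (m := i.scanEnd) I
    (fun m hm s' hs' => ?_) (fun s' hs' => ?_) h₁).mono (fun _ h => h) ?_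
  · exact ⟨⟨by simp [h.length], by simp [h.param], h.entry⟩, by simp [Term.val]⟩
  · obtain ⟨hg, h3⟩ := hs'
    obtain ⟨h1, h2⟩ := Source.of_lt_scanEnd hm
    refine ⟨?_, .assign ⟨⟨by simp [hg.length], by simp [hg.param], hg.entry⟩, ?_⟩⟩
    · simp only [scanTest, Term.val, hg.length, h3, hg.entry m h1, hg.entry (m - 1) (by omega)]
      omega
    · simp [Term.val, h3]
  · obtain ⟨hg, h3⟩ := hs'
    have hspec : i.list.length ≤ i.scanEnd ∨ i.entry i.scanEnd + i.entry (i.scanEnd - 1) = 0 :=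
      Nat.find_spec i.exists_scanEnd
    by_cases hlt : i.scanEnd < i.list.length
    · have h0 := hspec.resolve_left (by omega)
      simp only [scanTest, Term.val, hg.length, h3, hg.entry _ hlt,
        hg.entry (i.scanEnd - 1) (by omega)]
      omega
    · simp only [scanTest, Term.val, hg.length, h3]
      omega
  · simp only [scanTest, Term.cost]
    omega

/-- The time depends on `scanEnd` and not on the announced length: the construction runs only if the
two are equal. -/
theorem exists_reduction_program (d : ℕ) : ∃ p c, ∀ s i, Given s i →
    Runs p s (fun s' => s'.Presents (i.target d)) ((i.scanEnd + i.param + 3) ^ c) := by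
  obtain ⟨p, c, hp⟩ := exists_construct d
  refine ⟨.seq (.seq (.assign 3 (.const 0)) (.loop scanTest (.assign 3 (.add (.reg 3) (.const 1)))))
    (.ite (.sub (.reg 0) (.reg 3)) (.seq (.assign 0 (.const 0)) (.assign 1 (.const 0))) p),
    (24 + 1) + (8 + c + 1) + 1, fun s i h => ?_⟩
  have hw : 2 ≤ i.scanEnd + i.param + 3 := by omega
  set w := i.scanEnd + i.param + 3 with hwdef
  have h24 : 24 * i.scanEnd + 24 ≤ w ^ (24 + 1) := by
    have h1 := Nat.mul_le_mul_right w (le_pow_self hw 24)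
    rw [pow_succ]; omega
  have h8 : 8 + w ^ c ≤ w ^ (8 + c + 1) :=
    (Nat.add_le_add_right (le_pow_self hw 8) _).trans (add_pow_le hw _ _)
  refine ((runs_scan s i h).seq (T' := 8 + w ^ c) ?_).mono (fun _ h => h)
    ((Nat.add_le_add h24 h8).trans (add_pow_le hw _ _))
  rintro s' ⟨hg, h3⟩
  refine (Runs.ite (T := 4 + w ^ c) (fun hne => ?_) fun heq => ?_).mono (fun _ h => h)
    (by simp only [Term.cost]; omega)
  · simp only [Term.val, hg.length, h3] at hne
    refine ((Runs.assign (Q := fun s => s = _) rfl).seq (T' := 2) ?_).mono (fun _ h => h)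
      (by simp only [Term.cost]; omega)
    rintro _ rfl
    have ht : i.target d = ([], 0) := if_pos (by omega)
    rw [ht]
    exact .assign ⟨by simp [Term.val], by simp [Term.val], fun j hj => by simp at hj⟩
  · simp only [Term.val, hg.length, h3] at heq
    have hend : i.scanEnd = i.list.length := le_antisymm i.scanEnd_le (by omega)
    have ht : i.target d = i.image d := if_neg (by omega)
    rw [ht]
    refine (hp s' i hg).mono (fun _ h => h) ?_
    rw [hwdef, hend]
    exact Nat.le_add_left _ _

/-! ## Codes of most vital edges instances -/

theorem flatMap_finRange_injective {n : ℕ} {f g : Fin n → Fin n → ℕ}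
    (h : ((List.finRange n).flatMap fun u => (List.finRange n).map fun v => f u v) =
      (List.finRange n).flatMap fun u => (List.finRange n).map fun v => g u v) : f = g := by
  let e : (Fin n → Fin n → ℕ) → ℕ → ℕ → ℕ := fun f a b =>
    if h : a < n ∧ b < n then f ⟨a, h.1⟩ ⟨b, h.2⟩ else 0
  have he : ∀ f : Fin n → Fin n → ℕ,
      ((List.finRange n).flatMap fun u => (List.finRange n).map fun v => f u v) =
        (List.range (n * n)).map fun j => e f (j / n) (j % n) := by
    intro f
    rw [← Source.flatMap_finRange_eq]
    simp [e]
  rw [he, he, List.map_inj_left] at h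
  funext u v
  have hn : 0 < n := u.pos
  have := h (n * u + v) (List.mem_range.2 (by
    have : n * u + n ≤ n * n := by rw [← Nat.mul_succ]; exact Nat.mul_le_mul_left _ u.2
    omega))
  rw [Nat.mul_add_div hn, Nat.mul_add_mod, Nat.div_eq_of_lt v.2, Nat.mod_eq_of_lt v.2,
    Nat.add_zero] at this
  simpa [e] using this

theorem mstWeight_congr {V : Type*} [Fintype V] {G : SimpleGraph V} {w w' : Sym2 V → ℕ}
    (h : ∀ e ∈ G.edgeSet, w e = w' e) : mstWeight G w = mstWeight G w' := by
  classical
  unfold mstWeight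
  refine iInf_congr fun T => iInf_congr fun hT => congrArg _ ?_
  unfold totalWeight
  refine Finset.sum_congr rfl fun e he => h e (SimpleGraph.edgeSet_mono hT.1 ?_)
  simpa using he

/-- A code determines everything but the weights of non-edges, which do not affect the answer. This
makes membership in `MostVitalEdges` independent of the instance chosen for a code. -/
theorem MVEInput.IsYes.of_encode_eq {M M' : MVEInput} (hM : M.IsYes) (h : M.encode = M'.encode) :
    M'.IsYes := by
  obtain ⟨n, _, G, w, b, _, r, _⟩ := M
  obtain ⟨n', _, G', w', b', _, r', _⟩ := M'
  simp only [MVEInput.encode, List.cons.injEq] at h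
  obtain ⟨rfl, rfl, rfl, h⟩ := h
  have h := flatMap_finRange_injective h
  have hent : ∀ u v, (G.Adj u v ↔ G'.Adj u v) ∧ (G.Adj u v → w s(u, v) = w' s(u, v)) := by
    intro u v
    have := congrFun (congrFun h u) v
    by_cases h1 : G.Adj u v <;> by_cases h2 : G'.Adj u v <;> simp [h1, h2] at this ⊢
    exact this
  obtain rfl : G = G' := by
    ext u v; exact (hent u v).1
  obtain ⟨I, hI, hb, hr⟩ := hM
  refine ⟨I, hI, hb, hr.trans_eq (mstWeight_congr fun e he => ?_)⟩
  induction e with | _ u v =>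
  exact (hent u v).2 (SimpleGraph.deleteEdges_le (G := G) _ he)

theorem Source.target_mem_iff (i : Source) (d : ℕ) :
    i.target d ∈ MostVitalEdges ↔ (i.list, i.param) ∈ WeightedSat d := by
  unfold target
  split_ifs with h
  · refine iff_of_false ?_ (not_mem_weightedSat h d)
    rintro ⟨M, hM, -⟩
    simp [MVEInput.encode] at hM
  · rw [← instanceOf_isYes_iff]
    constructor
    · rintro ⟨M, hM, -, hyes⟩
      exact hyes.of_encode_eq (hM.symm.trans (i.encode_instanceOf d).symm)
    · intro hyes
      exact ⟨i.instanceOf d, (i.encode_instanceOf d).symm, rfl, hyes⟩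

/-! ## Composition of the reductions -/

/-- Each step writes to at most one cell. This bounds the nonzero entries of an output even when its
announced length is enormous. -/
theorem Exec.exists_support {p : Prog} {s s' : State} {t : ℕ} (h : Exec p s s' t) (A : Finset ℕ)
    (hA : ∀ j ∉ A, s.arr 0 j = 0) :
    ∃ A' : Finset ℕ, A'.card ≤ A.card + t ∧ ∀ j ∉ A', s'.arr 0 j = 0 := by
  induction h generalizing A with
  | skip | assign | loop_done => exact ⟨A, by omega, hA⟩
  | store s a e₁ e₂ =>
    refine ⟨insert (e₁.val s) A, (Finset.card_insert_le _ _).trans (by omega), fun j hj => ?_⟩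
    rw [Finset.mem_insert, not_or] at hj
    rw [State.setCell_arr, if_neg fun h => hj.1 h.2]
    exact hA j hj.2
  | seq _ _ ih₁ ih₂ =>
    obtain ⟨A₁, h1, hA₁⟩ := ih₁ A hA
    obtain ⟨A₂, h2, hA₂⟩ := ih₂ A₁ hA₁
    exact ⟨A₂, by omega, hA₂⟩
  | ite_true _ _ ih | ite_false _ _ ih =>
    obtain ⟨A₁, h1, hA₁⟩ := ih A hA
    exact ⟨A₁, by omega, hA₁⟩
  | loop_step _ _ _ ih₁ ih₂ =>
    obtain ⟨A₁, h1, hA₁⟩ := ih₁ A hA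
    obtain ⟨A₂, h2, hA₂⟩ := ih₂ A₁ hA₁
    exact ⟨A₂, by omega, hA₂⟩

theorem length_le_size (x : List ℕ) : x.length ≤ size x := by
  induction x with
  | nil => simp
  | cons m x ih => simp only [size, List.map_cons, List.sum_cons, List.length_cons] at *; omega

theorem computable_pow {f : ℕ → ℕ} (hf : Computable f) (c : ℕ) : Computable fun k => f k ^ c := by
  induction c with
  | zero => exact (Computable.const 1).of_eq fun _ => by simp
  | succ c ih => exact (Primrec.nat_mul.to_comp.comp ih hf).of_eq fun _ => (pow_succ _ _).symm

/-- The second program starts in the final state of the first, whatever else that contains. Its time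
is a power of a quantity bounded through the steps of the first program and the new parameter, so it
again splits into a computable function of the parameter times a power of the size. -/
theorem reduces_mostVitalEdges {A : Problem} {d : ℕ} (h : Reduces A (WeightedSat d)) :
    Reduces A MostVitalEdges := by
  obtain ⟨F, p, f, g, c, hf, hg, hF, hFg, hrun⟩ := h
  obtain ⟨q, c', hq⟩ := exists_reduction_program d
  let src : Instance → Source := fun x => ⟨(F x).1, (F x).2⟩
  have hadd := Primrec.nat_add.to_comp
  refine ⟨fun x => (src x).target d, .seq p q,
    fun k => f k + (2 * f k + g k + 6) ^ c', fun k => (g k + 2) ^ (d + 1), (c + 1) * c' + c,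
    ?_, ?_, fun x => ?_, fun x => ?_, fun x => ?_⟩
  · refine hadd.comp hf (computable_pow (hadd.comp (hadd.comp ?_ hg) (.const 6)) c')
    exact Primrec.nat_mul.to_comp.comp (.const 2) hf
  · exact computable_pow (hadd.comp hg (.const 2)) _
  · rw [Source.target_mem_iff]; exact hF x
  · dsimp only [Source.target]
    split_ifs
    · exact Nat.zero_le _
    · exact Nat.pow_le_pow_left (Nat.add_le_add_right (hFg x) 2) _
  · obtain ⟨s, t, hexec, ⟨h0, h1, hent⟩, ht⟩ := hrun x
    obtain ⟨s', t', hexec', hpres, ht'⟩ := hq s (src x) ⟨h0, h1, hent⟩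
    refine ⟨s', t + t', hexec.seq hexec', hpres, ?_⟩
    obtain ⟨B, hB, hB0⟩ := hexec.exists_support (Finset.range x.1.length) (by
      intro j hj
      simp [initial, List.getElem?_eq_none (by simpa using hj : x.1.length ≤ j)])
    rw [Finset.card_range] at hB
    have hend := (src x).scanEnd_le_of_support B fun j hj hjB => by
      rw [← hB0 j hjB]; exact (hent j hj).symm
    have hlen := length_le_size x.1
    have hk : (src x).param ≤ g x.2 := hFg x
    set S := size x.1 + 1 with hS
    have hS1 : 1 ≤ S := by omega
    have hSc : 1 ≤ S ^ c := Nat.one_le_pow _ _ hS1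
    have hSc1 : S ≤ S ^ (c + 1) := Nat.le_self_pow (by simp) _
    have hSc2 : S ^ c ≤ S ^ (c + 1) := Nat.pow_le_pow_right hS1 (by omega)
    -- The scan is at most twice the support plus one; the support is bounded by the input length
    -- plus the running time of the first program.
    have hw : (src x).scanEnd + (src x).param + 3 ≤ (2 * f x.2 + g x.2 + 6) * S ^ (c + 1) := by
      have h1 : f x.2 * S ^ c ≤ f x.2 * S ^ (c + 1) := Nat.mul_le_mul_left _ hSc2
      have h2 : g x.2 * 1 ≤ g x.2 * S ^ (c + 1) := Nat.mul_le_mul_left _ (hS1.trans hSc1)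
      have h3 : (2 * f x.2 + g x.2 + 6) * S ^ (c + 1) =
        2 * (f x.2 * S ^ (c + 1)) + g x.2 * S ^ (c + 1) + 6 * S ^ (c + 1) := by ring
      omega
    have h2 := ht'.trans (Nat.pow_le_pow_left hw c')
    rw [mul_pow, ← pow_mul] at h2
    have h3 : S ^ c ≤ S ^ ((c + 1) * c' + c) := Nat.pow_le_pow_right hS1 (by omega)
    have h4 : S ^ ((c + 1) * c') ≤ S ^ ((c + 1) * c' + c) := Nat.pow_le_pow_right hS1 (by omega)
    rw [add_mul]
    exact Nat.add_le_add (ht.trans (Nat.mul_le_mul_left _ h3)) (h2.trans (Nat.mul_le_mul_left _ h4))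

end ParamComplexity

theorem theorem1 : ParamComplexity.W1Hard ParamComplexity.MostVitalEdges := by
  rintro A ⟨d, h⟩
  exact ParamComplexity.reduces_mostVitalEdges h
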